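/- **Setting.** Let $F\in C^1([0,1])$ with $F(0)=F(1)=0$ and $F>0$ on $(0,1)$. For $n\ge 1$ consider the $n$-lane totally asymmetric exclusion model with lanes $0,\dots,n-1$: particles on lane $i$ jump to the right at rate $d_i=4nF(i/n)$, and transverse jumps go from lane $i+1$ to lane $i$ at rate $1$ (so that lanes of lower index fill up first). Write $q(i,j)$ for the transverse jump rates. For $\rho\in[0,n]$ let $(\widetilde\rho_0(\rho),\dots,\widetilde\rho_{n-1}(\rho))$ be the unique point of $[0,1]^n$ with $\rho_i(1-\rho_j)q(i,j)=\rho_j(1-\rho_i)q(j,i)$ for all $i\ne j$ and $\sum_i\rho_i=\rho$. The macroscopic flux of the model is $$G^n(\rho)=\sum_{i=0}^{n-1}d_i\,\widetilde\rho_i(\rho)\bigl(1-\widetilde\rho_i(\rho)\bigr)=\sum_{i=0}^{n-1}d_i(\rho-i)(i+1-\rho)\mathbf 1_{(i,i+1)}(\rho),\qquad \rho\in[0,n].$$ Let $\alpha,\beta\in[0,1]$ and $R_{\alpha,\beta}(x)=\alpha\mathbf 1_{\{x\le 0\}}+\beta\mathbf 1_{\{x>0\}}$. Let $u^n$ be the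 $[0,n]$-valued (Kružkov) entropy solution of $\partial_tu+\partial_xG^n(u)=0$ with initial datum $nR_{\alpha,\beta}$, taken continuous in time with values in $L^1_{\rm loc}(\mathbb R)$, and let $\widehat u^n=n^{-1}u^n$, which has initial datum $R_{\alpha,\beta}$. Define $\widehat u(\cdot,1)$ as follows: if $\alpha>\beta$, it is the $[0,1]$-valued entropy solution at time $1$ of $\partial_tu+\partial_xF(u)=0$ with initial datum $R_{\alpha,\beta}$; if $\alpha\le\beta$, then $\widehat u(\cdot,1)=R_{\alpha,\beta}$. **Theorem.** The functions $\widehat u(\cdot,1)$ and $\widehat u^n(\cdot,1)$, $n\ge1$, which are defined up to null sets, have essential left and right limits at every $v\in\mathbb R$. Let $\widehat U(v,1)$ be the closed interval with bounds $\widehat u(v\pm,1)$. For each choice of the values $\widehat u^n(v,1)$ in the closed intervals with bounds $\widehat u^n(v\pm,1)$: 1. for every $v\in\mathbb R$, $$\lim_{n\to\infty,\ w\to v}d\bigl[\widehat u^n(w,1);\widehat U(v,1)\bigr]=0,$$ that is, for every $\varepsilon>0$ there are $\delta>0$ and $n_0$ such that $d[\widehat u^n(w,1);\widehat U(v,1)]<\varepsilon$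 whenever $n\ge n_0$ and $|w-v|<\delta$; 2. $\lim_{n\to\infty}d[\widehat u^n(v,1);\widehat U(v,1)]=0$ locally uniformly in $v\in\mathbb R$ if $\alpha\le\beta$, and locally uniformly on the set of those $v$ with $\widehat u(v-,1)=\widehat u(v+,1)$ if $\alpha>\beta$; 3. in particular, $\widehat u^n(v,1)\to\widehat u(v\pm,1)$ at every $v$ with $\widehat u(v-,1)=\widehat u(v+,1)$ (every point of continuity of $\widehat u(\cdot,1)$). -/

import Mathlib

open Set Filter Topology MeasureTheory
open scoped ContDiff

/-! ### The `n`-lane model: equilibrium manifold, lane densities, macroscopic flux -/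

/-- The equilibrium manifold of the transverse jump kernel `q` on the lanes `0, …, n - 1`:
lane densities in `[0,1]` that satisfy the detailed balance relations. -/
def equilibriumManifold {n : ℕ} (q : Fin n → Fin n → ℝ) : Set (Fin n → ℝ) :=
  {r | (∀ i, r i ∈ Icc (0 : ℝ) 1) ∧
    ∀ i j, i ≠ j → r i * (1 - r j) * q i j = r j * (1 - r i) * q j i}

/-- The total density `ψ(ρ₀, …, ρₙ₋₁) = ρ₀ + ⋯ + ρₙ₋₁`. -/
def totalDensity {n : ℕ} (r : Fin n → ℝ) : ℝ := ∑ i, r i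

/-- The lane densities as functions of the total density, that is, the inverse of the
restriction of `totalDensity` to the equilibrium manifold. -/
noncomputable def laneDensity {n : ℕ} (q : Fin n → Fin n → ℝ) (ρ : ℝ) : Fin n → ℝ :=
  Function.invFunOn totalDensity (equilibriumManifold q) ρ

/-- The macroscopic flux `G(ρ) = ∑ᵢ γᵢ ρ̃ᵢ(ρ) (1 - ρ̃ᵢ(ρ))` of the model with transverse kernel `q`
and mean drift `γᵢ` on lane `i`. -/
noncomputable def macroFlux {n : ℕ} (q : Fin n → Fin n → ℝ) (γ : Fin n → ℝ) (ρ : ℝ) : ℝ :=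
  ∑ i, γ i * (laneDensity q ρ i * (1 - laneDensity q ρ i))

/-- Totally asymmetric nearest-neighbour transverse kernel: a particle on lane `j + 1` jumps to
lane `j` at rate `1`, so that lanes of lower index fill up first. -/
def transverseKernel (n : ℕ) (i j : Fin n) : ℝ := if (j : ℕ) + 1 = i then 1 else 0

/-- The jump rates `dᵢ = 4 n F(i/n)` (jumps to the right only) on the lanes. -/
noncomputable def laneRate (F : ℝ → ℝ) (n : ℕ) (i : Fin n) : ℝ := 4 * n * F ((i : ℝ) / n)

/-- The flux `Gⁿ` on `[0,n]` of the `n`-lane totally asymmetric model with rates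
`dᵢ = 4 n F(i/n)`. -/
noncomputable def laneFlux (F : ℝ → ℝ) (n : ℕ) : ℝ → ℝ :=
  macroFlux (transverseKernel n) (laneRate F n)

/-! ### Entropy solutions -/

/-- The Riemann datum, `α` on `(-∞, 0]` and `β` on `(0, ∞)`. -/
noncomputable def riemann (α β : ℝ) (x : ℝ) : ℝ := if x ≤ 0 then α else β

/-- `u` (with time as the first argument) is the `[0,M]`-valued entropy solution of
`∂ₜ u + ∂ₓ f(u) = 0` with initial datum `u₀`, in the sense of Kružkov. -/
structure IsEntropySolution (M : ℝ) (f : ℝ → ℝ) (u₀ : ℝ → ℝ) (u : ℝ → ℝ → ℝ) : Prop where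
  measurable : Measurable (Function.uncurry u)
  range : ∀ t, 0 ≤ t → ∀ x, u t x ∈ Icc 0 M
  /-- `∂ₜ |u - c| + ∂ₓ (sgn(u - c) (f(u) - f(c))) ≤ 0` in the sense of distributions on
  `(0,∞) × ℝ`. -/
  entropy : ∀ c ∈ Icc 0 M, ∀ φ : ℝ × ℝ → ℝ, ContDiff ℝ ∞ φ → HasCompactSupport φ →
    tsupport φ ⊆ {p | 0 < p.1} → (∀ p, 0 ≤ φ p) →
    0 ≤ ∫ p : ℝ × ℝ, (|u p.1 p.2 - c| * fderiv ℝ φ p (1, 0)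
      + Real.sign (u p.1 p.2 - c) * (f (u p.1 p.2) - f c) * fderiv ℝ φ p (0, 1))
  initial : ∀ a b, a < b → Tendsto (fun t => ∫ x in a..b, |u t x - u₀ x|) (𝓝[>] 0) (𝓝 0)
  /-- The version that is continuous in time with values in `L¹_loc(ℝ)` is taken; this gives
  `u(·,t)` a meaning, up to null sets, at each fixed time `t`. -/
  continuous : ∀ a b, a < b → ∀ s, 0 < s →
    Tendsto (fun t => ∫ x in a..b, |u t x - u s x|) (𝓝 s) (𝓝 0)

/-! ### One-sided limits of functions that are defined up to null sets -/

/-- `w` has (essential) left and right limits at every point. -/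
def HasTraces (w : ℝ → ℝ) : Prop :=
  ∀ v, (∃ l, Tendsto w (𝓝[<] v ⊓ ae volume) (𝓝 l)) ∧
    ∃ r, Tendsto w (𝓝[>] v ⊓ ae volume) (𝓝 r)

/-- The (essential) left limit `w(v-)`. -/
noncomputable def leftTrace (w : ℝ → ℝ) (v : ℝ) : ℝ := limUnder (𝓝[<] v ⊓ ae volume) w

/-- The (essential) right limit `w(v+)`. -/
noncomputable def rightTrace (w : ℝ → ℝ) (v : ℝ) : ℝ := limUnder (𝓝[>] v ⊓ ae volume) w

/-- The closed interval with bounds `w(v-)` and `w(v+)`. -/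
noncomputable def traceInterval (w : ℝ → ℝ) (v : ℝ) : Set ℝ :=
  uIcc (leftTrace w v) (rightTrace w v)

/-! ### The lane densities and the flux are given by the expected explicit formulas -/

theorem mem_equilibriumManifold_transverseKernel {n : ℕ} {r : Fin n → ℝ} :
    r ∈ equilibriumManifold (transverseKernel n) ↔
      (∀ i, r i ∈ Icc (0 : ℝ) 1) ∧ ∀ i j : Fin n, (j : ℕ) + 1 = i → r i * (1 - r j) = 0 := by
  unfold equilibriumManifold transverseKernel
  simp only [mem_ofPred_eq]
  refine and_congr_right fun _ => ⟨fun h i j hij => ?_, fun h i j _ => ?_⟩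
  · have h1 := h i j (fun e => by subst e; omega)
    rw [if_pos hij, if_neg (by omega)] at h1
    simpa using h1
  · split_ifs with h1 h2 h2
    · omega
    · simpa using h i j h1
    · simpa using (h j i h2).symm
    · simp

theorem equilibrium_lt {n : ℕ} {r : Fin n → ℝ}
    (hr : r ∈ equilibriumManifold (transverseKernel n)) {k i : Fin n} (hki : k < i) :
    r i * (1 - r k) = 0 := by
  rw [mem_equilibriumManifold_transverseKernel] at hr
  obtain ⟨m, hm⟩ := i
  induction m with
  | zero => exact absurd hki (by simp [Fin.lt_def])
  | succ m ih =>
    have h1 := hr.2 ⟨m + 1, hm⟩ ⟨m, by omega⟩ rfl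
    rcases Nat.lt_or_ge k m with h | h
    · have h2 := ih (by omega) (by simpa [Fin.lt_def] using h)
      rcases mul_eq_zero.1 h1 with h3 | h3
      · simp [h3]
      · rcases mul_eq_zero.1 h2 with h4 | h4
        · rw [h4] at h3
          norm_num at h3
        · simp [h4]
    · have : k = ⟨m, by omega⟩ := by
        apply Fin.ext
        have : (k : ℕ) < m + 1 := hki
        simp
        omega
      rw [this]
      exact h1

theorem totalDensity_injOn (n : ℕ) :
    InjOn totalDensity (equilibriumManifold (transverseKernel n)) := by
  have key : ∀ a ∈ equilibriumManifold (transverseKernel n),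
      ∀ b ∈ equilibriumManifold (transverseKernel n), ∀ i, a i < b i →
        totalDensity a < totalDensity b := by
    intro a ha b hb i hi
    refine Finset.sum_lt_sum (fun k _ => ?_) ⟨i, Finset.mem_univ _, hi⟩
    rcases lt_trichotomy k i with h | h | h
    · rcases mul_eq_zero.1 (equilibrium_lt hb h) with h1 | h1
      · linarith [(ha.1 i).1]
      · linarith [(ha.1 k).2]
    · rw [h]
      exact hi.le
    · rcases mul_eq_zero.1 (equilibrium_lt ha h) with h1 | h1
      · linarith [(hb.1 k).1]
      · linarith [(hb.1 i).2]
  intro a ha b hb hab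
  funext i
  rcases lt_trichotomy (a i) (b i) with h | h | h
  · exact absurd hab (key a ha b hb i h).ne
  · exact h
  · exact absurd hab (key b hb a ha i h).ne'

theorem sum_clamp (n : ℕ) (ρ : ℝ) (h0 : 0 ≤ ρ) :
    ∑ i : Fin n, max 0 (min 1 (ρ - (i : ℕ))) = min (n : ℝ) ρ := by
  induction n with
  | zero => simp [h0]
  | succ n ih =>
    rw [Fin.sum_univ_castSucc]
    simp only [Fin.val_castSucc, Fin.val_last, ih, Nat.cast_add, Nat.cast_one]
    have : (0 : ℝ) ≤ n := Nat.cast_nonneg n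
    rcases le_total (n : ℝ) ρ with h1 | h1 <;> rcases le_total (n + 1 : ℝ) ρ with h2 | h2
    · rw [min_eq_left h1, min_eq_left h2, min_eq_left (by linarith), max_eq_right zero_le_one]
    · rw [min_eq_left h1, min_eq_right h2, min_eq_right (by linarith),
        max_eq_right (by linarith)]
      ring
    · linarith
    · rw [min_eq_right h1, min_eq_right h2, min_eq_right (by linarith),
        max_eq_left (by linarith)]
      ring

/-- Lanes of lower index are full, lanes of higher index are empty. -/
theorem laneDensity_eq {n : ℕ} {ρ : ℝ} (hρ : ρ ∈ Icc (0 : ℝ) n) (i : Fin n) :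
    laneDensity (transverseKernel n) ρ i = max 0 (min 1 (ρ - (i : ℕ))) := by
  set c : Fin n → ℝ := fun i => max 0 (min 1 (ρ - (i : ℕ))) with hc
  have hcm : c ∈ equilibriumManifold (transverseKernel n) := by
    rw [mem_equilibriumManifold_transverseKernel]
    refine ⟨fun i => ⟨le_max_left _ _, max_le zero_le_one (min_le_left _ _)⟩, fun i j hij => ?_⟩
    have hij' : ((i : ℕ) : ℝ) = (j : ℕ) + 1 := by rw [← hij]; push_cast; ring
    simp only [hc]
    rcases le_total (ρ - (i : ℕ)) 0 with h | h
    · rw [max_eq_left ((min_le_right _ _).trans h), zero_mul]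
    · rw [min_eq_left (b := ρ - (j : ℕ)) (by linarith), max_eq_right zero_le_one, sub_self,
        mul_zero]
  have hct : totalDensity c = ρ := by
    simp only [totalDensity, hc]
    rw [sum_clamp n ρ hρ.1, min_eq_right hρ.2]
  have hex : ∃ a ∈ equilibriumManifold (transverseKernel n), totalDensity a = ρ := ⟨c, hcm, hct⟩
  have : laneDensity (transverseKernel n) ρ = c :=
    totalDensity_injOn n (Function.invFunOn_mem hex) hcm
      ((Function.invFunOn_eq hex).trans hct.symm)
  rw [this]

/-- The flux is a succession of hills: on `(i, i + 1)` it equals `dᵢ (ρ - i) (i + 1 - ρ)`. -/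
theorem laneFlux_eq (F : ℝ → ℝ) {n : ℕ} {ρ : ℝ} (hρ : ρ ∈ Icc (0 : ℝ) n) :
    laneFlux F n ρ = ∑ i : Fin n, laneRate F n i *
      (Ioo ((i : ℕ) : ℝ) ((i : ℕ) + 1)).indicator
        (fun s => (s - (i : ℕ)) * ((i : ℕ) + 1 - s)) ρ := by
  unfold laneFlux macroFlux
  refine Finset.sum_congr rfl fun i _ => ?_
  rw [laneDensity_eq hρ]
  congr 1
  by_cases h : ρ ∈ Ioo ((i : ℕ) : ℝ) ((i : ℕ) + 1)
  · rw [indicator_of_mem h, min_eq_right (by linarith [h.2]), max_eq_right (by linarith [h.1])]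
    ring
  · rw [indicator_of_notMem h]
    rcases le_or_gt ρ (i : ℕ) with h1 | h1
    · rw [max_eq_left ((min_le_right _ _).trans (by linarith)), zero_mul]
    · have h2 : ((i : ℕ) : ℝ) + 1 ≤ ρ := not_lt.1 fun h2 => h ⟨h1, h2⟩
      rw [min_eq_left (by linarith), max_eq_right zero_le_one, sub_self, mul_zero]

/-!
For Riemann data the entropy solution at time `1` is given by an optimization problem: if
`a ≤ b`, then for almost every `x` the value `u(x,1)` maximizes `c x - f(c)` over `c ∈ [a,b]`, and
if `a ≥ b` it maximizes `f(c) - c x` over `c ∈ [b,a]`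
(`IsEntropySolution.ae_mem_maximizers`, `IsEntropySolution.ae_mem_maximizers_neg`). The second case
is the first one for `M - u`. The first is the Hopf formula for the potential `w` with `∂ₓw = u` and
`∂ₜw = -f(u)`, and it is read off directly from the entropy inequalities, without the `L¹`
contraction of Kružkov:

* Integrating the inequality for `η(u) = (c - u)⁺` over a large interval, outside of which `u` is
  known by finite speed of propagation, bounds `∫ (c - u(x,1))⁺ dx`. This bounds
  `∫ (c - u(x,1)) dx` over each left part of the interval, and the bound says
  `w(x,1) ≥ c x - f(c)` (`IsEntropySolution.le_cutPrimitive`).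
* Conversely, along the ray from the origin to `(x,1)` the potential grows at rate
  `u x - f(u) ≤ max_c (c x - f(c))`, because `u ∈ [a,b]`. Made rigorous with a smooth front that
  moves at speed `x`, this gives `w(x,1) ≤ max_c (c x - f(c))`
  (`IsEntropySolution.cutPrimitive_le`).

Hence `w(·,1)` touches the line `y ↦ c y - f(c)` from above at `x` when `c` is a maximizer at `x`,
and where `w(·,1)` is differentiable its derivative `u(x,1)` is that maximizer.

Sets of maximizers are monotone in `x` and have closed graph. So any selection has one-sided limits,
and these are the extreme maximizers (`hasTracesIn_maximizers`). It remains to compare maximizers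
for the fluxes `Gⁿ(n c) / n` with those of the limit. The normalized flux oscillates between `0`,
attained at all multiples of `1 / n`, and hills of height `F(i / n)`. For decreasing data only the
upper envelope `F` matters, up to `O(1 / n)`
(`exists_infDist_maximizers_scaledFlux_lt`). For increasing data only the zeros matter: for `x > 0`
the maximizers lie within one lane of `β`, and for `x < 0` within one lane of `α`, uniformly in `x`
(`infDist_traceInterval_riemann_le`).
-/

/-! ### Smooth steps -/

/-- The derivative of the smooth step `Real.smoothTransition`: a smooth bump on `[0, 1]` of
integral `1`. -/
noncomputable def stepDeriv : ℝ → ℝ := deriv Real.smoothTransition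

theorem hasDerivAt_step (y : ℝ) : HasDerivAt Real.smoothTransition (stepDeriv y) y :=
  ((Real.smoothTransition.contDiff (n := 1)).differentiable one_ne_zero y).hasDerivAt

theorem continuous_stepDeriv : Continuous stepDeriv :=
  (Real.smoothTransition.contDiff (n := 1)).continuous_deriv le_rfl

theorem stepDeriv_nonneg (y : ℝ) : 0 ≤ stepDeriv y :=
  Real.smoothTransition.monotone.deriv_nonneg

theorem stepDeriv_eq_zero {y : ℝ} (hy : y ≤ 0 ∨ 1 ≤ y) : stepDeriv y = 0 := by
  rcases hy with hy | hy
  · have : IsLocalMin Real.smoothTransition y := Eventually.of_forall fun z => by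
      rw [Real.smoothTransition.zero_of_nonpos hy]
      exact Real.smoothTransition.nonneg z
    exact this.deriv_eq_zero
  · have : IsLocalMax Real.smoothTransition y := Eventually.of_forall fun z => by
      rw [Real.smoothTransition.one_of_one_le hy]
      exact Real.smoothTransition.le_one z
    exact this.deriv_eq_zero

theorem stepDeriv_eq_zero_of_notMem {y : ℝ} (hy : y ∉ Icc (0 : ℝ) 1) : stepDeriv y = 0 := by
  apply stepDeriv_eq_zero
  by_contra! h
  exact hy ⟨h.1.le, h.2.le⟩

theorem hasDerivAt_step_comp {g : ℝ → ℝ} {g' t : ℝ} (hg : HasDerivAt g g' t) :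
    HasDerivAt (fun s => Real.smoothTransition (g s)) (stepDeriv (g t) * g') t :=
  (hasDerivAt_step (g t)).comp t hg

theorem integrable_stepDeriv : Integrable stepDeriv :=
  continuous_stepDeriv.integrable_of_hasCompactSupport
    (HasCompactSupport.intro isCompact_Icc fun _ hx => stepDeriv_eq_zero_of_notMem hx)

theorem integral_stepDeriv : ∫ y, stepDeriv y = 1 := by
  have h := integral_of_hasDerivAt_of_tendsto (f := Real.smoothTransition) (m := 0) (n := 1)
    hasDerivAt_step integrable_stepDeriv ?_ ?_
  · simpa using h
  · refine tendsto_const_nhds.congr' ?_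
    filter_upwards [eventually_le_atBot 0] with x hx
    rw [Real.smoothTransition.zero_of_nonpos hx]
  · refine tendsto_const_nhds.congr' ?_
    filter_upwards [eventually_ge_atTop 1] with x hx
    rw [Real.smoothTransition.one_of_one_le hx]

theorem integrable_stepDeriv_scaled {r : ℝ} (hr : 0 < r) (a : ℝ) :
    Integrable fun x => stepDeriv ((x - a) / r) / r :=
  ((integrable_stepDeriv.comp_div hr.ne').comp_sub_right a).div_const r

theorem integral_stepDeriv_scaled {r : ℝ} (hr : 0 < r) (a : ℝ) :
    ∫ x, stepDeriv ((x - a) / r) / r = 1 := by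
  rw [integral_sub_right_eq_self (fun x => stepDeriv (x / r) / r) a, integral_div,
    Measure.integral_comp_div, integral_stepDeriv, abs_of_pos hr]
  simp [hr.ne']

/-! ### Testing monotonicity with smooth functions of time -/

theorem integrable_mul_of_bound_on_support {X : Type*} [MeasurableSpace X] {μ : Measure X}
    {b g : X → ℝ} {C : ℝ} (hb : Measurable b) (hg : Integrable g μ)
    (h : ∀ x, g x ≠ 0 → |b x| ≤ C) : Integrable (fun x => b x * g x) μ := by
  refine (hg.norm.const_mul C).mono' (hb.aestronglyMeasurable.mul hg.aestronglyMeasurable)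
    (Eventually.of_forall fun x => ?_)
  rw [norm_mul, Real.norm_eq_abs (b x)]
  by_cases hx : g x = 0
  · simp [hx]
  · exact mul_le_mul_of_nonneg_right (h x hx) (norm_nonneg _)

theorem integrable_mul_of_continuousOn {D g : ℝ → ℝ} {K : Set ℝ} (hK : IsCompact K)
    (hD : ContinuousOn D K) (hg : Continuous g) (h : ∀ x, x ∉ K → g x = 0) :
    Integrable fun x => g x * D x := by
  rw [← integrableOn_iff_integrable_of_support_subset (s := K)]
  · exact (hg.continuousOn.mul hD).integrableOn_compact hK
  · intro x hx
    by_contra hxK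
    exact hx (by simp [h x hxK])

/-- A continuous function whose distributional derivative is nonpositive is nonincreasing: test
with the difference of two translates of a steep step. -/
theorem antitoneOn_of_integral_deriv_mul_nonneg {D : ℝ → ℝ} {T : ℝ}
    (hD : ContinuousOn D (Ioo 0 T))
    (h : ∀ χ : ℝ → ℝ, ContDiff ℝ ∞ χ → ∀ a b, 0 < a → b < T → (∀ t, t ∉ Icc a b → χ t = 0) →
      (∀ t, 0 ≤ χ t) → 0 ≤ ∫ t, deriv χ t * D t) :
    AntitoneOn D (Ioo 0 T) := by
  intro s hs t ht hst
  by_contra! hlt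
  have hst' : s < t := lt_of_le_of_ne hst fun e => by simp [e] at hlt
  have hcs : Tendsto (fun y => D (s + y)) (𝓝 0) (𝓝 (D s)) := by
    have := (hD.continuousAt (Ioo_mem_nhds hs.1 hs.2)).tendsto
    exact this.comp (by
      simpa using tendsto_const_nhds.add (tendsto_id (α := ℝ) (x := 𝓝 0)) (a := s))
  have hct : Tendsto (fun y => D (t + y)) (𝓝 0) (𝓝 (D t)) := by
    have := (hD.continuousAt (Ioo_mem_nhds ht.1 ht.2)).tendsto
    exact this.comp (by
      simpa using tendsto_const_nhds.add (tendsto_id (α := ℝ) (x := 𝓝 0)) (a := t))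
  obtain ⟨κ, hκ, hκ'⟩ : ∃ κ, 0 < κ ∧ D s - D t < -κ :=
    ⟨(D t - D s) / 2, by linarith, by linarith⟩
  have hev : ∀ᶠ y in 𝓝 (0 : ℝ), D (s + y) - D (t + y) < -κ := (hcs.sub hct).eventually_lt_const hκ'
  obtain ⟨ρ, hρ, hρ'⟩ := Metric.eventually_nhds_iff.1 hev
  obtain ⟨r, hr, hrρ, hrT⟩ : ∃ r, 0 < r ∧ r < ρ ∧ t + r < T := by
    refine ⟨min ρ (T - t) / 2, ?_, ?_, ?_⟩
    · have := lt_min hρ (sub_pos.2 ht.2); linarith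
    · have := min_le_left ρ (T - t); linarith
    · have := min_le_right ρ (T - t); have := ht.2; linarith
  set χ : ℝ → ℝ := fun τ => Real.smoothTransition ((τ - s) / r) -
    Real.smoothTransition ((τ - t) / r) with hχ
  have hχd : ∀ τ, HasDerivAt χ (stepDeriv ((τ - s) / r) / r - stepDeriv ((τ - t) / r) / r) τ := by
    intro τ
    have h1 : ∀ c, HasDerivAt (fun τ => (τ - c) / r) (1 / r) τ := fun c =>
      ((hasDerivAt_id τ).sub_const c).div_const r
    convert! (hasDerivAt_step_comp (h1 s)).sub (hasDerivAt_step_comp (h1 t)) using 1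
    ring
  have h0 := h χ ?_ s (t + r) hs.1 hrT ?_ ?_
  · have hint : ∀ c ∈ Ioo 0 T, c + r < T →
        Integrable fun τ => stepDeriv ((τ - c) / r) / r * D τ := by
      intro c hc hcT
      refine integrable_mul_of_continuousOn (K := Icc c (c + r)) isCompact_Icc
        (hD.mono fun y hy => ⟨hc.1.trans_le hy.1, hy.2.trans_lt hcT⟩)
        ((continuous_stepDeriv.comp (by fun_prop)).div_const r) fun x hx => ?_
      rw [stepDeriv_eq_zero_of_notMem, zero_div]
      contrapose! hx
      rw [mem_Icc, le_div_iff₀ hr, div_le_iff₀ hr] at hx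
      exact ⟨by linarith, by linarith⟩
    have i2 : ∀ c ∈ Ioo 0 T, c + r < T →
        Integrable fun y => stepDeriv (y / r) / r * D (c + y) := by
      intro c hc hcT
      simpa [add_comm] using (hint c hc hcT).comp_add_right c
    have i3 : Integrable fun y => stepDeriv (y / r) / r * (D (s + y) - D (t + y)) := by
      simp only [mul_sub]
      exact (i2 s hs (by linarith)).sub (i2 t ht hrT)
    have hI : ∫ τ, deriv χ τ * D τ =
        ∫ y, stepDeriv (y / r) / r * (D (s + y) - D (t + y)) := by
      have e1 : ∀ c, ∫ τ, stepDeriv ((τ - c) / r) / r * D τ =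
          ∫ y, stepDeriv (y / r) / r * D (c + y) := by
        intro c
        rw [← integral_add_right_eq_self _ c]
        simp [add_comm]
      simp only [(hχd _).deriv, sub_mul, mul_sub]
      rw [integral_sub (hint s hs (by linarith)) (hint t ht hrT),
        integral_sub (i2 s hs (by linarith)) (i2 t ht hrT), e1, e1]
    have hle : ∫ y, stepDeriv (y / r) / r * (D (s + y) - D (t + y)) ≤
        ∫ y, stepDeriv ((y - 0) / r) / r * (-κ) := by
      refine integral_mono i3 ((integrable_stepDeriv_scaled hr 0).mul_const _) fun y => ?_
      simp only [sub_zero]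
      by_cases hy : y / r ∈ Icc (0 : ℝ) 1
      · rw [mem_Icc, le_div_iff₀ hr, div_le_iff₀ hr] at hy
        refine mul_le_mul_of_nonneg_left (hρ' ?_).le (div_nonneg (stepDeriv_nonneg _) hr.le)
        rw [Real.dist_eq, sub_zero, abs_of_nonneg (by linarith)]
        linarith
      · simp [stepDeriv_eq_zero_of_notMem hy]
    rw [integral_mul_const, integral_stepDeriv_scaled hr 0] at hle
    linarith
  · exact (Real.smoothTransition.contDiff.comp (by fun_prop)).sub
      (Real.smoothTransition.contDiff.comp (by fun_prop))
  · intro τ hτ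
    simp only [hχ]
    rcases lt_or_ge τ s with h1 | h1
    · rw [Real.smoothTransition.zero_of_nonpos, Real.smoothTransition.zero_of_nonpos, sub_self]
      · exact div_nonpos_of_nonpos_of_nonneg (by linarith) hr.le
      · exact div_nonpos_of_nonpos_of_nonneg (by linarith) hr.le
    · have h2 : t + r < τ := by
        by_contra! h2
        exact hτ ⟨h1, h2⟩
      rw [Real.smoothTransition.one_of_one_le, Real.smoothTransition.one_of_one_le, sub_self]
      · rw [le_div_iff₀ hr]; linarith
      · rw [le_div_iff₀ hr]; linarith
  · intro τ
    have : (τ - t) / r ≤ (τ - s) / r := by gcongr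
    linarith [Real.smoothTransition.monotone this]

/-! ### Integrated entropy inequalities -/

/-- `u`, with values in `[0,M]` and initial datum `u₀`, is continuous in time with values in
`L¹_loc(ℝ)` and satisfies `∂ₜ η(u) + ∂ₓ q(u) ≤ 0` in the sense of distributions on
`(0,∞) × ℝ`. -/
structure EntropyPair (M : ℝ) (u₀ : ℝ → ℝ) (u : ℝ → ℝ → ℝ) (η q : ℝ → ℝ) : Prop where
  measurable : Measurable (Function.uncurry u)
  measurable_init : Measurable u₀
  range : ∀ t, 0 ≤ t → ∀ x, u t x ∈ Icc 0 M
  range_init : ∀ x, u₀ x ∈ Icc 0 M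
  lipschitz : ∃ Λ, LipschitzWith Λ η
  measurable_flux : Measurable q
  bounded_flux : ∃ C, ∀ r ∈ Icc 0 M, |q r| ≤ C
  entropy : ∀ φ : ℝ × ℝ → ℝ, ContDiff ℝ ∞ φ → HasCompactSupport φ →
    tsupport φ ⊆ {p | 0 < p.1} → (∀ p, 0 ≤ φ p) →
    0 ≤ ∫ p : ℝ × ℝ, (η (u p.1 p.2) * fderiv ℝ φ p (1, 0) + q (u p.1 p.2) * fderiv ℝ φ p (0, 1))
  initial : ∀ a b, a < b → Tendsto (fun t => ∫ x in a..b, |u t x - u₀ x|) (𝓝[>] 0) (𝓝 0)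
  continuous : ∀ a b, a < b → ∀ s, 0 < s →
    Tendsto (fun t => ∫ x in a..b, |u t x - u s x|) (𝓝 s) (𝓝 0)

theorem integrable_of_bound_on_Icc {g : ℝ → ℝ} (hg : Measurable g) {B C : ℝ}
    (hC : ∀ x, |g x| ≤ C) (h0 : ∀ x, B ≤ |x| → g x = 0) : Integrable g := by
  rw [← integrableOn_iff_integrable_of_support_subset (s := Icc (-B) B)]
  · exact Measure.integrableOn_of_bounded (M := C) (by simp) hg.aestronglyMeasurable
      (Eventually.of_forall hC)
  · intro x hx
    by_contra hxB
    refine hx (h0 x ?_)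
    by_contra! h
    exact hxB (abs_le.1 h.le)

theorem tendsto_weighted_integral {l : Filter ℝ} [l.IsCountablyGenerated] {s B C M : ℝ}
    {Λ : NNReal} {η : ℝ → ℝ} {u : ℝ → ℝ → ℝ} {v : ℝ → ℝ} {ψ : ℝ × ℝ → ℝ} (hB : 0 < B)
    (hl : l ≤ 𝓝 s) (hη : LipschitzWith Λ η) (hηC : ∀ r ∈ Icc 0 M, |η r| ≤ C)
    (hum : ∀ t, Measurable (u t)) (hvm : Measurable v)
    (hu : ∀ᶠ t in l, ∀ x, u t x ∈ Icc 0 M) (hv : ∀ x, v x ∈ Icc 0 M)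
    (hψ : Continuous ψ) (hψ0 : ∀ p, 0 ≤ ψ p) (hψ1 : ∀ p, ψ p ≤ 1)
    (hsup : ∀ᶠ t in l, ∀ x, B ≤ |x| → ψ (t, x) = 0)
    (hlim : Tendsto (fun t => ∫ x in (-B)..B, |u t x - v x|) l (𝓝 0)) :
    Tendsto (fun t => ∫ x, η (u t x) * ψ (t, x)) l (𝓝 (∫ x, η (v x) * ψ (s, x))) := by
  have hψm : ∀ t, Measurable fun x => ψ (t, x) := fun t => by fun_prop
  have hηm : Measurable η := hη.continuous.measurable
  have hψa : ∀ p, |ψ p| ≤ 1 := fun p => abs_le.2 ⟨by linarith [hψ0 p], hψ1 p⟩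
  have hC0 : 0 ≤ C := (abs_nonneg _).trans (hηC _ (hv 0))
  have key : ∀ (w : ℝ → ℝ), Measurable w → (∀ x, w x ∈ Icc 0 M) → ∀ t,
      (∀ x, B ≤ |x| → ψ (t, x) = 0) → Integrable fun x => η (w x) * ψ (t, x) := by
    intro w hw hwM t ht
    refine integrable_of_bound_on_Icc (C := C) (B := B) ((hηm.comp hw).mul (hψm t)) ?_ ?_
    · intro x
      rw [abs_mul]
      exact (mul_le_mul (hηC _ (hwM x)) (hψa _) (abs_nonneg _) hC0).trans_eq (mul_one C)
    · intro x hx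
      simp [ht x hx]
  have h1 : Tendsto (fun t => ∫ x, η (v x) * ψ (t, x)) l (𝓝 (∫ x, η (v x) * ψ (s, x))) := by
    refine tendsto_integral_filter_of_dominated_convergence
      ((Icc (-B) B).indicator fun _ => C) (Eventually.of_forall fun t =>
        ((hηm.comp hvm).mul (hψm t)).aestronglyMeasurable) ?_ ?_ ?_
    · filter_upwards [hsup] with t ht
      refine Eventually.of_forall fun x => ?_
      by_cases hx : x ∈ Icc (-B) B
      · rw [indicator_of_mem hx, Real.norm_eq_abs, abs_mul]
        exact (mul_le_mul (hηC _ (hv x)) (hψa _) (abs_nonneg _) hC0).trans_eq (mul_one C)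
      · rw [indicator_of_notMem hx, ht x (not_lt.1 fun h => hx (abs_le.1 h.le))]
        simp
    · exact (integrable_indicator_iff measurableSet_Icc).2 (by simp)
    · refine Eventually.of_forall fun x => ?_
      have : Tendsto (fun t => ψ (t, x)) l (𝓝 (ψ (s, x))) := by
        have h2 : Continuous fun t => ψ (t, x) := by fun_prop
        exact (h2.tendsto s).mono_left hl
      exact tendsto_const_nhds.mul this
  have h2 : Tendsto (fun t => ∫ x, (η (u t x) * ψ (t, x) - η (v x) * ψ (t, x))) l (𝓝 0) := by
    refine squeeze_zero_norm' ?_ (by simpa using hlim.const_mul (Λ : ℝ))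
    filter_upwards [hsup, hu] with t ht hut
    have hsub : ∀ x, |η (u t x) * ψ (t, x) - η (v x) * ψ (t, x)| ≤
        (Ioc (-B) B).indicator (fun x => Λ * |u t x - v x|) x := by
      intro x
      by_cases hx : x ∈ Ioc (-B) B
      · rw [indicator_of_mem hx, ← sub_mul, abs_mul]
        have := hη.dist_le_mul (u t x) (v x)
        rw [Real.dist_eq, Real.dist_eq] at this
        exact (mul_le_mul this (hψa _) (abs_nonneg _) (by positivity)).trans_eq (mul_one _)
      · rw [indicator_of_notMem hx, ht x]
        · simp
        · by_contra! h
          exact hx ⟨(abs_lt.1 h).1, (abs_lt.1 h).2.le⟩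
    have hint : IntegrableOn (fun x => (Λ : ℝ) * |u t x - v x|) (Ioc (-B) B) := by
      refine Measure.integrableOn_of_bounded (M := Λ * M) (by simp)
        (((hum t).sub hvm).norm.const_mul _).aestronglyMeasurable
        (Eventually.of_forall fun x => ?_)
      rw [Real.norm_eq_abs, abs_mul, abs_abs, NNReal.abs_eq]
      refine mul_le_mul_of_nonneg_left ?_ Λ.2
      have h3 := hut x
      have h4 := hv x
      exact abs_le.2 ⟨by linarith [h3.1, h4.2], by linarith [h3.2, h4.1]⟩
    calc ‖∫ x, (η (u t x) * ψ (t, x) - η (v x) * ψ (t, x))‖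
        ≤ ∫ x, (Ioc (-B) B).indicator (fun x => Λ * |u t x - v x|) x :=
          norm_integral_le_of_norm_le ((integrable_indicator_iff measurableSet_Ioc).2 hint)
            (Eventually.of_forall hsub)
      _ = Λ * ∫ x in (-B)..B, |u t x - v x| := by
          rw [integral_indicator measurableSet_Ioc, integral_const_mul,
            intervalIntegral.integral_of_le (by linarith)]
  have h3 := h2.add h1
  rw [zero_add] at h3
  refine h3.congr' ?_
  filter_upwards [hsup, hu] with t ht hut
  rw [integral_sub (key _ (hum t) hut t ht) (key v hvm hv t ht)]
  ring

namespace EntropyPair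

variable {M : ℝ} {u₀ : ℝ → ℝ} {u : ℝ → ℝ → ℝ} {η q : ℝ → ℝ}

theorem exists_bound (h : EntropyPair M u₀ u η q) :
    ∃ C, ∀ r ∈ Icc 0 M, |η r| ≤ C ∧ |q r| ≤ C := by
  obtain ⟨Λ, hΛ⟩ := h.lipschitz
  obtain ⟨C1, hC1⟩ := isCompact_Icc.exists_bound_of_continuousOn
    (hΛ.continuous.continuousOn (s := Icc 0 M))
  obtain ⟨C2, hC2⟩ := h.bounded_flux
  exact ⟨max C1 C2, fun r hr => ⟨(hC1 r hr).trans (le_max_left _ _),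
    (hC2 r hr).trans (le_max_right _ _)⟩⟩

theorem measurable_slice (h : EntropyPair M u₀ u η q) (t : ℝ) : Measurable (u t) :=
  h.measurable.comp (measurable_const.prodMk measurable_id)

theorem measurable_entropy (h : EntropyPair M u₀ u η q) : Measurable η := by
  obtain ⟨Λ, hΛ⟩ := h.lipschitz
  exact hΛ.continuous.measurable

/-- The inequality against a product test function `χ(t) ψ(t,x)`, once the space integral of
`η(u) ∂ₜψ + q(u) ∂ₓψ` is bounded by `k`. -/
theorem integral_deriv_mul_nonneg (h : EntropyPair M u₀ u η q) {ψ : ℝ × ℝ → ℝ} {T B k : ℝ}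
    (hψ : ContDiff ℝ ∞ ψ) (hψ0 : ∀ p, 0 ≤ ψ p)
    (hsup : ∀ t ∈ Icc 0 T, ∀ x, B ≤ |x| → ψ (t, x) = 0)
    (hG : ContinuousOn (fun t => ∫ x, η (u t x) * ψ (t, x)) (Ioo 0 T))
    (hk : ∀ t ∈ Ioo 0 T, ∫ x, (η (u t x) * fderiv ℝ ψ (t, x) (1, 0) +
      q (u t x) * fderiv ℝ ψ (t, x) (0, 1)) ≤ k)
    {χ : ℝ → ℝ} (hχ : ContDiff ℝ ∞ χ) {a b : ℝ} (ha : 0 < a) (hb : b < T)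
    (hχs : ∀ t, t ∉ Icc a b → χ t = 0) (hχ0 : ∀ t, 0 ≤ χ t) :
    0 ≤ ∫ t, deriv χ t * ((∫ x, η (u t x) * ψ (t, x)) - k * t) := by
  obtain ⟨C, hC⟩ := h.exists_bound
  set G : ℝ → ℝ := fun t => ∫ x, η (u t x) * ψ (t, x) with hGdef
  set φ : ℝ × ℝ → ℝ := fun p => χ p.1 * ψ p with hφdef
  have hφ : ContDiff ℝ ∞ φ := (hχ.comp contDiff_fst).mul hψ
  have hχd : ∀ t, HasDerivAt χ (deriv χ t) t := fun t =>
    (hχ.differentiable (by simp) t).hasDerivAt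
  have hχ'c : Continuous (deriv χ) := hχ.continuous_deriv (by simp)
  have hχ's : ∀ t, t ∉ Icc a b → deriv χ t = 0 := by
    intro t ht
    have : χ =ᶠ[𝓝 t] fun _ => 0 := by
      filter_upwards [isClosed_Icc.isOpen_compl.mem_nhds ht] with s hs using hχs s hs
    simpa using this.deriv_eq
  have hab : ∀ t ∈ Icc a b, t ∈ Ioo 0 T := fun t ht => ⟨ha.trans_le ht.1, ht.2.trans_lt hb⟩
  have hψd : Differentiable ℝ ψ := hψ.differentiable (by simp)
  have hψ'c : ∀ v, Continuous fun p => fderiv ℝ ψ p v := fun v =>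
    (hψ.continuous_fderiv (by simp)).clm_apply continuous_const
  have hφ'c : ∀ v, Continuous fun p => fderiv ℝ φ p v := fun v =>
    (hφ.continuous_fderiv (by simp)).clm_apply continuous_const
  have hφ' : ∀ p v, fderiv ℝ φ p v = deriv χ p.1 * v.1 * ψ p + χ p.1 * fderiv ℝ ψ p v := by
    intro p v
    have h1 : HasFDerivAt (fun p : ℝ × ℝ => χ p.1)
        (deriv χ p.1 • ContinuousLinearMap.fst ℝ ℝ ℝ) p :=
      (hχd p.1).comp_hasFDerivAt p hasFDerivAt_fst
    have h2 : HasFDerivAt φ _ p := h1.mul (hψd p).hasFDerivAt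
    rw [h2.fderiv]
    simp
    ring
  -- the support of the test function
  have hK : IsCompact (Icc a b ×ˢ Icc (-B) B) := isCompact_Icc.prod isCompact_Icc
  have hφK : ∀ p, p ∉ Icc a b ×ˢ Icc (-B) B → φ p = 0 := by
    intro p hp
    by_cases h1 : p.1 ∈ Icc a b
    · have h2 : B ≤ |p.2| := by
        by_contra! h2
        exact hp ⟨h1, abs_le.1 h2.le⟩
      simp [hφdef, hsup p.1 (Ioo_subset_Icc_self (hab _ h1)) p.2 h2]
    · simp [hφdef, hχs _ h1]
  have hφcs : HasCompactSupport φ := HasCompactSupport.intro hK hφK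
  have htsK : tsupport φ ⊆ Icc a b ×ˢ Icc (-B) B := by
    refine closure_minimal (fun p hp => ?_) hK.isClosed
    by_contra hpK
    exact hp (hφK p hpK)
  have hpos : ∀ v p, fderiv ℝ φ p v ≠ 0 → 0 < p.1 := by
    intro v p hp
    have : p ∈ tsupport φ := support_fderiv_subset ℝ (f := φ) fun h0 => hp (by simp [h0])
    exact ha.trans_le (htsK this).1.1
  have hφ'i : ∀ v, Integrable fun p => fderiv ℝ φ p v := fun v =>
    (hφ'c v).integrable_of_hasCompactSupport (hφcs.fderiv_apply (𝕜 := ℝ) v)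
  have hent := h.entropy φ hφ hφcs (fun p hp => ha.trans_le (htsK hp).1.1)
    fun p => mul_nonneg (hχ0 _) (hψ0 _)
  have hI1 : Integrable fun p : ℝ × ℝ => η (u p.1 p.2) * fderiv ℝ φ p (1, 0) :=
    integrable_mul_of_bound_on_support (C := C) (h.measurable_entropy.comp h.measurable)
      (hφ'i _) fun p hp => (hC _ (h.range _ (hpos _ p hp).le _)).1
  have hI2 : Integrable fun p : ℝ × ℝ => q (u p.1 p.2) * fderiv ℝ φ p (0, 1) :=
    integrable_mul_of_bound_on_support (C := C) (h.measurable_flux.comp h.measurable)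
      (hφ'i _) fun p hp => (hC _ (h.range _ (hpos _ p hp).le _)).2
  have hI : Integrable fun p : ℝ × ℝ => η (u p.1 p.2) * fderiv ℝ φ p (1, 0) +
      q (u p.1 p.2) * fderiv ℝ φ p (0, 1) := hI1.add hI2
  have hinner : ∀ t, ∫ x, (η (u t x) * fderiv ℝ φ (t, x) (1, 0) +
      q (u t x) * fderiv ℝ φ (t, x) (0, 1)) ≤ deriv χ t * G t + χ t * k := by
    intro t
    by_cases ht : t ∈ Icc a b
    · have ht' := hab t ht
      have hcpt : ∀ v, Integrable fun x => fderiv ℝ ψ (t, x) v := by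
        intro v
        refine ((hψ'c v).comp (by fun_prop)).integrable_of_hasCompactSupport
          (HasCompactSupport.intro (isCompact_Icc (a := -B) (b := B)) fun x hx => ?_)
        have hx' : B < |x| := by
          by_contra! h1
          exact hx (abs_le.1 h1)
        have : ψ =ᶠ[𝓝 (t, x)] fun _ => 0 := by
          have h1 : ∀ᶠ s in 𝓝 t, s ∈ Ioo 0 T := Ioo_mem_nhds ht'.1 ht'.2
          have h2 : ∀ᶠ y in 𝓝 x, B < |y| := continuous_abs.continuousAt.eventually_const_lt hx'
          filter_upwards [h1.prod_nhds h2] with p hp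
          exact hsup p.1 (Ioo_subset_Icc_self hp.1) p.2 hp.2.le
        simp [this.fderiv_eq]
      have hψi : Integrable fun x => ψ (t, x) := by
        refine (hψ.continuous.comp (by fun_prop)).integrable_of_hasCompactSupport
          (HasCompactSupport.intro (isCompact_Icc (a := -B) (b := B)) fun x hx => ?_)
        refine hsup t (Ioo_subset_Icc_self ht') x ?_
        by_contra! h1
        exact hx (abs_le.1 h1.le)
      have hηm := h.measurable_entropy.comp (h.measurable_slice t)
      have hqm := h.measurable_flux.comp (h.measurable_slice t)
      have j1 : Integrable fun x => η (u t x) * ψ (t, x) :=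
        integrable_mul_of_bound_on_support hηm hψi fun x _ => (hC _ (h.range t ht'.1.le x)).1
      have j2 : Integrable fun x => η (u t x) * fderiv ℝ ψ (t, x) (1, 0) :=
        integrable_mul_of_bound_on_support hηm (hcpt _)
          fun x _ => (hC _ (h.range t ht'.1.le x)).1
      have j3 : Integrable fun x => q (u t x) * fderiv ℝ ψ (t, x) (0, 1) :=
        integrable_mul_of_bound_on_support hqm (hcpt _)
          fun x _ => (hC _ (h.range t ht'.1.le x)).2
      have j4 : Integrable fun x => η (u t x) * fderiv ℝ ψ (t, x) (1, 0) +
          q (u t x) * fderiv ℝ ψ (t, x) (0, 1) := j2.add j3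
      have e : ∀ x, η (u t x) * fderiv ℝ φ (t, x) (1, 0) +
          q (u t x) * fderiv ℝ φ (t, x) (0, 1) = deriv χ t * (η (u t x) * ψ (t, x)) +
          χ t * (η (u t x) * fderiv ℝ ψ (t, x) (1, 0) +
            q (u t x) * fderiv ℝ ψ (t, x) (0, 1)) := by
        intro x
        rw [hφ', hφ']
        ring
      simp only [e]
      rw [integral_add (j1.const_mul _) (j4.const_mul _), integral_const_mul,
        integral_const_mul]
      have := mul_le_mul_of_nonneg_left (hk t ht') (hχ0 t)
      linarith
    · have e : ∀ x, η (u t x) * fderiv ℝ φ (t, x) (1, 0) +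
          q (u t x) * fderiv ℝ φ (t, x) (0, 1) = 0 := by
        intro x
        rw [hφ', hφ']
        simp [hχs t ht, hχ's t ht]
      simp [e, hχs t ht, hχ's t ht]
  have hχcs : HasCompactSupport χ := HasCompactSupport.intro isCompact_Icc hχs
  have hχi : Integrable χ := hχ.continuous.integrable_of_hasCompactSupport hχcs
  have hGi : Integrable fun t => deriv χ t * G t :=
    integrable_mul_of_continuousOn isCompact_Icc (hG.mono hab) hχ'c hχ's
  have hti : Integrable fun t => deriv χ t * (k * t) :=
    integrable_mul_of_continuousOn (D := fun t => k * t) isCompact_Icc (by fun_prop) hχ'c hχ's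
  have hparts : ∫ t, deriv χ t * (k * t) = -∫ t, χ t * k := by
    have h1 : Integrable fun t => χ t * (k * t) :=
      integrable_mul_of_continuousOn (D := fun t => k * t) isCompact_Icc (by fun_prop)
        hχ.continuous hχs
    have h2 := integral_eq_zero_of_hasDerivAt_of_integrable
      (fun t => (hχd t).mul (((hasDerivAt_id t).const_mul k))) (by
        simp only [id, mul_one]
        exact hti.add (hχi.mul_const k)) h1
    simp only [id, mul_one] at h2
    rw [integral_add hti (hχi.mul_const k)] at h2
    linarith
  have hfub : ∫ p : ℝ × ℝ, (η (u p.1 p.2) * fderiv ℝ φ p (1, 0) +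
      q (u p.1 p.2) * fderiv ℝ φ p (0, 1)) ≤ ∫ t, (deriv χ t * G t + χ t * k) := by
    rw [Measure.volume_eq_prod] at hI ⊢
    rw [integral_prod _ hI]
    exact integral_mono hI.integral_prod_left (hGi.add (hχi.mul_const k)) hinner
  simp only [mul_sub]
  rw [integral_sub hGi hti, hparts, sub_neg_eq_add,
    ← integral_add hGi (hχi.mul_const k)]
  exact hent.trans hfub

/-- **Integrated entropy inequality.** The smooth weight `ψ` may move in time; its support in space
has to stay bounded on `[0,T]`. The limits at the two ends of the time interval are where the
continuity in time and the initial condition enter. -/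
theorem integral_le (h : EntropyPair M u₀ u η q) {ψ : ℝ × ℝ → ℝ} {T B k : ℝ} (hT : 0 < T)
    (hB : 0 < B) (hψ : ContDiff ℝ ∞ ψ) (hψ0 : ∀ p, 0 ≤ ψ p) (hψ1 : ∀ p, ψ p ≤ 1)
    (hsup : ∀ t ∈ Icc 0 T, ∀ x, B ≤ |x| → ψ (t, x) = 0)
    (hk : ∀ t ∈ Ioo 0 T, ∫ x, (η (u t x) * fderiv ℝ ψ (t, x) (1, 0) +
      q (u t x) * fderiv ℝ ψ (t, x) (0, 1)) ≤ k) :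
    ∫ x, η (u T x) * ψ (T, x) ≤ (∫ x, η (u₀ x) * ψ (0, x)) + k * T := by
  obtain ⟨C, hC⟩ := h.exists_bound
  obtain ⟨Λ, hΛ⟩ := h.lipschitz
  have hηC : ∀ r ∈ Icc 0 M, |η r| ≤ C := fun r hr => (hC r hr).1
  have hBB : -B < B := by linarith
  have hG : ContinuousOn (fun t => ∫ x, η (u t x) * ψ (t, x)) (Ioo 0 T) := by
    refine fun s hs => ContinuousAt.continuousWithinAt ?_
    have hm : Ioo 0 T ∈ 𝓝 s := Ioo_mem_nhds hs.1 hs.2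
    refine tendsto_weighted_integral hB le_rfl hΛ hηC h.measurable_slice (h.measurable_slice s)
      ?_ (h.range s hs.1.le) hψ.continuous hψ0 hψ1 ?_
      (h.continuous (-B) B hBB s hs.1)
    · filter_upwards [hm] with t ht using h.range t ht.1.le
    · filter_upwards [hm] with t ht using hsup t (Ioo_subset_Icc_self ht)
  have hTl : Tendsto (fun t => ∫ x, η (u t x) * ψ (t, x)) (𝓝[<] T)
      (𝓝 (∫ x, η (u T x) * ψ (T, x))) := by
    have hm : Ioo 0 T ∈ 𝓝[<] T := Ioo_mem_nhdsLT hT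
    refine tendsto_weighted_integral hB nhdsWithin_le_nhds hΛ hηC h.measurable_slice
      (h.measurable_slice T) ?_ (h.range T hT.le) hψ.continuous hψ0 hψ1 ?_
      ((h.continuous (-B) B hBB T hT).mono_left nhdsWithin_le_nhds)
    · filter_upwards [hm] with t ht using h.range t ht.1.le
    · filter_upwards [hm] with t ht using hsup t (Ioo_subset_Icc_self ht)
  have h0r : Tendsto (fun t => ∫ x, η (u t x) * ψ (t, x)) (𝓝[>] 0)
      (𝓝 (∫ x, η (u₀ x) * ψ (0, x))) := by
    have hm : Ioo 0 T ∈ 𝓝[>] (0 : ℝ) := Ioo_mem_nhdsGT hT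
    refine tendsto_weighted_integral hB nhdsWithin_le_nhds hΛ hηC h.measurable_slice
      h.measurable_init ?_ h.range_init hψ.continuous hψ0 hψ1 ?_
      (h.initial (-B) B hBB)
    · filter_upwards [hm] with t ht using h.range t ht.1.le
    · filter_upwards [hm] with t ht using hsup t (Ioo_subset_Icc_self ht)
  have hanti := antitoneOn_of_integral_deriv_mul_nonneg
    (D := fun t => (∫ x, η (u t x) * ψ (t, x)) - k * t) (T := T)
    (hG.sub (by fun_prop)) fun χ hχ a b ha hb hχs hχ0 =>
      h.integral_deriv_mul_nonneg hψ hψ0 hsup hG hk hχ ha hb hχs hχ0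
  have hlim0 : Tendsto (fun t => (∫ x, η (u t x) * ψ (t, x)) - k * t) (𝓝[>] 0)
      (𝓝 (∫ x, η (u₀ x) * ψ (0, x))) := by
    have : Tendsto (fun t : ℝ => k * t) (𝓝[>] 0) (𝓝 (k * 0)) :=
      tendsto_nhdsWithin_of_tendsto_nhds ((continuous_const.mul continuous_id).tendsto 0)
    simpa using h0r.sub this
  have hlimT : Tendsto (fun t => (∫ x, η (u t x) * ψ (t, x)) - k * t) (𝓝[<] T)
      (𝓝 ((∫ x, η (u T x) * ψ (T, x)) - k * T)) := by
    have : Tendsto (fun t : ℝ => k * t) (𝓝[<] T) (𝓝 (k * T)) :=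
      tendsto_nhdsWithin_of_tendsto_nhds ((continuous_const.mul continuous_id).tendsto T)
    exact hTl.sub this
  have hst : ∀ t ∈ Ioo 0 T, (∫ x, η (u t x) * ψ (t, x)) - k * t ≤
      ∫ x, η (u₀ x) * ψ (0, x) := by
    intro t ht
    refine ge_of_tendsto hlim0 ?_
    filter_upwards [Ioo_mem_nhdsGT ht.1] with s hs
    exact hanti ⟨hs.1, hs.2.trans ht.2⟩ ht hs.2.le
  have := le_of_tendsto hlimT (by
    filter_upwards [Ioo_mem_nhdsLT hT] with t ht using hst t ht)
  linarith

end EntropyPair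

/-! ### Entropy pairs of an entropy solution -/

theorem integral_fderiv_eq_zero {φ : ℝ × ℝ → ℝ} (hφ : ContDiff ℝ ∞ φ)
    (hφc : HasCompactSupport φ) (v : ℝ × ℝ) : ∫ p, fderiv ℝ φ p v = 0 := by
  have h1 : Integrable fun p => fderiv ℝ φ p v :=
    ((hφ.continuous_fderiv (by simp)).clm_apply continuous_const).integrable_of_hasCompactSupport
      (hφc.fderiv_apply (𝕜 := ℝ) v)
  have h2 : Integrable φ := hφ.continuous.integrable_of_hasCompactSupport hφc
  have := integral_mul_fderiv_eq_neg_fderiv_mul_of_integrable (μ := volume)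
    (f := fun _ : ℝ × ℝ => (1 : ℝ)) (g := φ) (v := v) (by simp) (by simpa using h1)
    (by simpa using h2) (fun _ _ => by fun_prop)
    (fun x _ => hφ.differentiable (by simp) x)
  simpa using this

theorem measurable_real_sign : Measurable Real.sign :=
  Measurable.ite measurableSet_Iio measurable_const
    (Measurable.ite measurableSet_Ioi measurable_const measurable_const)

theorem abs_sign_le_one (r : ℝ) : |Real.sign r| ≤ 1 := by
  rcases Real.sign_apply_eq r with h | h | h <;> simp [h]

namespace EntropyPair

variable {M : ℝ} {u₀ : ℝ → ℝ} {u : ℝ → ℝ → ℝ} {f η q : ℝ → ℝ}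

/-- Nonnegative combinations of two Kružkov pairs and a constant pair are entropy pairs. -/
theorem of_combination {L : NNReal} (h : IsEntropySolution M f u₀ u) (hm : Measurable u₀)
    (hr : ∀ x, u₀ x ∈ Icc 0 M) (hf : LipschitzWith L f) {c₁ c₂ l₁ l₂ k₁ k₂ : ℝ}
    (hc₁ : c₁ ∈ Icc 0 M) (hc₂ : c₂ ∈ Icc 0 M) (hl₁ : 0 ≤ l₁) (hl₂ : 0 ≤ l₂)
    (hη : ∃ Λ, LipschitzWith Λ η) (hq : Measurable q)
    (eη : ∀ r ∈ Icc 0 M, η r = l₁ * |r - c₁| + l₂ * |r - c₂| + k₁)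
    (eq : ∀ r ∈ Icc 0 M, q r = l₁ * (Real.sign (r - c₁) * (f r - f c₁)) +
      l₂ * (Real.sign (r - c₂) * (f r - f c₂)) + k₂) :
    EntropyPair M u₀ u η q := by
  have hb : ∀ c ∈ Icc 0 M, ∀ r ∈ Icc 0 M, |Real.sign (r - c) * (f r - f c)| ≤ L * M := by
    intro c hc r hr
    have h1 := hf.dist_le_mul r c
    rw [Real.dist_eq, Real.dist_eq] at h1
    have h2 : |r - c| ≤ M := abs_le.2 ⟨by linarith [hr.1, hc.2], by linarith [hr.2, hc.1]⟩
    rw [abs_mul]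
    calc |Real.sign (r - c)| * |f r - f c| ≤ 1 * |f r - f c| :=
          mul_le_mul_of_nonneg_right (abs_sign_le_one _) (abs_nonneg _)
      _ ≤ L * M := by
          rw [one_mul]
          exact h1.trans (mul_le_mul_of_nonneg_left h2 L.2)
  refine ⟨h.measurable, hm, h.range, hr, hη, hq, ⟨l₁ * (L * M) + l₂ * (L * M) + |k₂|, ?_⟩, ?_,
    h.initial, h.continuous⟩
  · intro r hr
    rw [eq r hr]
    refine (abs_add_le _ _).trans (add_le_add_left ((abs_add_le _ _).trans ?_) _)
    rw [abs_mul l₁, abs_mul l₂, abs_of_nonneg hl₁, abs_of_nonneg hl₂]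
    gcongr
    · exact hb c₁ hc₁ r hr
    · exact hb c₂ hc₂ r hr
  · intro φ hφ hφc hφs hφ0
    have hi : ∀ v, Integrable fun p => fderiv ℝ φ p v := fun v =>
      ((hφ.continuous_fderiv (by simp)).clm_apply
        continuous_const).integrable_of_hasCompactSupport (hφc.fderiv_apply (𝕜 := ℝ) v)
    have hpos : ∀ v p, fderiv ℝ φ p v ≠ 0 → 0 < p.1 := fun v p hp =>
      hφs (support_fderiv_subset ℝ (f := φ) fun h0 => hp (by simp [h0]))
    have hI : ∀ c ∈ Icc 0 M, Integrable fun p : ℝ × ℝ =>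
        (|u p.1 p.2 - c| * fderiv ℝ φ p (1, 0)
      + Real.sign (u p.1 p.2 - c) * (f (u p.1 p.2) - f c) * fderiv ℝ φ p (0, 1)) := by
      intro c hc
      have hmu : Measurable fun p : ℝ × ℝ => u p.1 p.2 := h.measurable
      have hfm : Measurable f := hf.continuous.measurable
      refine Integrable.add (integrable_mul_of_bound_on_support (C := M)
        (hmu.sub_const c).norm (hi _) fun p hp => ?_)
        (integrable_mul_of_bound_on_support (C := L * M)
          ((measurable_real_sign.comp (hmu.sub_const c)).mul ((hfm.comp hmu).sub_const _)) (hi _)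
          fun p hp => hb c hc _ (h.range _ (hpos _ p hp).le _))
      have h1 := h.range _ (hpos _ p hp).le p.2
      rw [abs_abs]
      exact abs_le.2 ⟨by linarith [h1.1, hc.2], by linarith [h1.2, hc.1]⟩
    have e : ∀ p : ℝ × ℝ, η (u p.1 p.2) * fderiv ℝ φ p (1, 0) +
        q (u p.1 p.2) * fderiv ℝ φ p (0, 1) =
        l₁ * (|u p.1 p.2 - c₁| * fderiv ℝ φ p (1, 0)
      + Real.sign (u p.1 p.2 - c₁) * (f (u p.1 p.2) - f c₁) * fderiv ℝ φ p (0, 1)) +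
        l₂ * (|u p.1 p.2 - c₂| * fderiv ℝ φ p (1, 0)
      + Real.sign (u p.1 p.2 - c₂) * (f (u p.1 p.2) - f c₂) * fderiv ℝ φ p (0, 1)) +
        (k₁ * fderiv ℝ φ p (1, 0) + k₂ * fderiv ℝ φ p (0, 1)) := by
      intro p
      by_cases hp : 0 < p.1
      · rw [eη _ (h.range _ hp.le _), eq _ (h.range _ hp.le _)]
        ring
      · have h0 : ∀ v, fderiv ℝ φ p v = 0 := fun v => by
          by_contra h1
          exact hp (hpos v p h1)
        simp [h0]
    have i1 := (hI c₁ hc₁).const_mul l₁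
    have i2 := (hI c₂ hc₂).const_mul l₂
    have i3 := ((hi (1, 0)).const_mul k₁)
    have i4 := ((hi (0, 1)).const_mul k₂)
    simp only [e]
    rw [integral_add (by exact i1.add i2) (by exact i3.add i4), integral_add i1 i2,
      integral_add i3 i4, integral_const_mul, integral_const_mul, integral_const_mul,
      integral_const_mul, integral_fderiv_eq_zero hφ hφc, integral_fderiv_eq_zero hφ hφc]
    have j1 := mul_nonneg hl₁ (h.entropy c₁ hc₁ φ hφ hφc hφs hφ0)
    have j2 := mul_nonneg hl₂ (h.entropy c₂ hc₂ φ hφ hφc hφs hφ0)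
    linarith

section

variable {L : NNReal} (h : IsEntropySolution M f u₀ u) (hm : Measurable u₀)
  (hr : ∀ x, u₀ x ∈ Icc 0 M) (hf : LipschitzWith L f) {c : ℝ} (hc : c ∈ Icc 0 M)
include h hm hr hf

theorem conservation : EntropyPair M u₀ u (fun r => r) (fun r => f r - f 0) := by
  have h0 : (0 : ℝ) ∈ Icc 0 M := ⟨le_rfl, (hr 0).1.trans (hr 0).2⟩
  refine of_combination h hm hr hf (l₁ := 1) (l₂ := 0) (k₁ := 0) (k₂ := 0) h0 h0 zero_le_one
    le_rfl ⟨1, LipschitzWith.id⟩ (hf.continuous.measurable.sub_const _) ?_ ?_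
  · intro r hr
    simp [abs_of_nonneg hr.1]
  · intro r hr
    rcases hr.1.eq_or_lt with h1 | h1
    · simp [← h1]
    · simp [Real.sign_of_pos h1]

include hc

theorem kruzkov :
    EntropyPair M u₀ u (fun r => |r - c|) (fun r => Real.sign (r - c) * (f r - f c)) := by
  refine of_combination h hm hr hf (l₁ := 1) (l₂ := 0) (k₁ := 0) (k₂ := 0) hc hc zero_le_one
    le_rfl ⟨1, ?_⟩ ?_ ?_ ?_
  · refine LipschitzWith.of_dist_le_mul fun x y => ?_
    rw [Real.dist_eq, Real.dist_eq, NNReal.coe_one, one_mul]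
    exact (abs_abs_sub_abs_le _ _).trans_eq (by ring_nf)
  · exact (measurable_real_sign.comp (measurable_id.sub_const c)).mul
      (hf.continuous.measurable.sub_const _)
  · simp
  · simp

theorem posPart_sub : EntropyPair M u₀ u (fun r => max (r - c) 0)
    (fun r => if c < r then f r - f c else 0) := by
  have h0 : (0 : ℝ) ∈ Icc 0 M := ⟨le_rfl, (hr 0).1.trans (hr 0).2⟩
  refine of_combination h hm hr hf (l₁ := 1 / 2) (l₂ := 1 / 2) (k₁ := -c / 2)
    (k₂ := (f 0 - f c) / 2) hc h0 (by norm_num) (by norm_num) ⟨1, ?_⟩ ?_ ?_ ?_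
  · refine LipschitzWith.of_dist_le_mul fun x y => ?_
    rw [Real.dist_eq, Real.dist_eq, NNReal.coe_one, one_mul]
    exact (abs_max_sub_max_le_abs _ _ _).trans_eq (by ring_nf)
  · exact Measurable.ite measurableSet_Ioi (hf.continuous.measurable.sub_const _) measurable_const
  · intro r hr
    rw [sub_zero, abs_of_nonneg hr.1]
    rcases le_total r c with h1 | h1
    · rw [max_eq_right (by linarith), abs_of_nonpos (by linarith)]; ring
    · rw [max_eq_left (by linarith), abs_of_nonneg (by linarith)]; ring
  · intro r hr
    have e0 : Real.sign (r - 0) * (f r - f 0) = f r - f 0 := by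
      rcases hr.1.eq_or_lt with h1 | h1
      · simp [← h1]
      · simp [Real.sign_of_pos h1]
    rw [e0]
    rcases lt_trichotomy r c with h1 | h1 | h1
    · rw [if_neg (by linarith), Real.sign_of_neg (by linarith)]; ring
    · rw [if_neg (by linarith), h1]; ring
    · rw [if_pos h1, Real.sign_of_pos (by linarith)]; ring

/-- The second Kružkov pair that enters is the one at `c = M`, which on `[0,M]` is affine in `r` and
turns `|r - c|` into `(c - r)⁺`. -/
theorem posPart_const_sub : EntropyPair M u₀ u (fun r => max (c - r) 0)
    (fun r => if r < c then f c - f r else 0) := by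
  have hM : M ∈ Icc 0 M := ⟨(hr 0).1.trans (hr 0).2, le_rfl⟩
  refine of_combination h hm hr hf (l₁ := 1 / 2) (l₂ := 1 / 2) (k₁ := (c - M) / 2)
    (k₂ := (f c - f M) / 2) hc hM (by norm_num) (by norm_num) ⟨1, ?_⟩ ?_ ?_ ?_
  · refine LipschitzWith.of_dist_le_mul fun x y => ?_
    rw [Real.dist_eq, Real.dist_eq, NNReal.coe_one, one_mul]
    refine (abs_max_sub_max_le_abs _ _ _).trans_eq ?_
    rw [abs_sub_comm]
    ring_nf
  · exact Measurable.ite measurableSet_Iio (measurable_const.sub hf.continuous.measurable)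
      measurable_const
  · intro r hr
    rw [abs_of_nonpos (by linarith [hr.2] : r - M ≤ 0)]
    rcases le_total r c with h1 | h1
    · rw [max_eq_left (by linarith), abs_of_nonpos (by linarith)]; ring
    · rw [max_eq_right (by linarith), abs_of_nonneg (by linarith)]; ring
  · intro r hr
    have e0 : Real.sign (r - M) * (f r - f M) = f M - f r := by
      rcases hr.2.eq_or_lt with h1 | h1
      · simp [h1]
      · rw [Real.sign_of_neg (by linarith)]; ring
    rw [e0]
    rcases lt_trichotomy r c with h1 | h1 | h1
    · rw [if_pos h1, Real.sign_of_neg (by linarith)]; ring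
    · rw [if_neg (by linarith), h1]; ring
    · rw [if_neg (by linarith), Real.sign_of_pos (by linarith)]; ring

end

end EntropyPair

/-! ### Finite speed of propagation -/

theorem fderiv_apply_fst {ψ : ℝ × ℝ → ℝ} {t x d : ℝ} (hψ : DifferentiableAt ℝ ψ (t, x))
    (h : HasDerivAt (fun s => ψ (s, x)) d t) : fderiv ℝ ψ (t, x) (1, 0) = d :=
  (hψ.hasFDerivAt.comp_hasDerivAt t ((hasDerivAt_id t).prodMk (hasDerivAt_const t x))).unique h

theorem fderiv_apply_snd {ψ : ℝ × ℝ → ℝ} {t x d : ℝ} (hψ : DifferentiableAt ℝ ψ (t, x))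
    (h : HasDerivAt (fun y => ψ (t, y)) d x) : fderiv ℝ ψ (t, x) (0, 1) = d :=
  (hψ.hasFDerivAt.comp_hasDerivAt x ((hasDerivAt_const x t).prodMk (hasDerivAt_id x))).unique h

namespace EntropyPair

variable {M : ℝ} {u₀ : ℝ → ℝ} {u : ℝ → ℝ → ℝ} {f η q : ℝ → ℝ}

/-- If `η ≥ 0` and `|q| ≤ L η`, then `η(u)` vanishes in the cone of slope `L` above an interval on
which it vanishes initially. The hyperbola `√(1 + (x - a)²)` stands for `|x - a|`, so as to give a
smooth weight. -/
theorem ae_eq_zero_in_cone (h : EntropyPair M u₀ u η q) {L a B T : ℝ} (hL : 0 ≤ L)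
    (hη : ∀ r ∈ Icc 0 M, 0 ≤ η r) (hq : ∀ r ∈ Icc 0 M, |q r| ≤ L * η r) (hT : 0 < T)
    (h0 : ∀ x, |x - a| < B → η (u₀ x) = 0) :
    ∀ᵐ x, √(1 + (x - a) ^ 2) < B - L * T → η (u T x) = 0 := by
  obtain ⟨C, hC⟩ := h.exists_bound
  have hpos : ∀ x : ℝ, 0 < 1 + (x - a) ^ 2 := fun x => by positivity
  have hroot : ∀ x : ℝ, |x - a| ≤ √(1 + (x - a) ^ 2) := fun x =>
    Real.abs_le_sqrt (by linarith)
  set ψ : ℝ × ℝ → ℝ := fun p =>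
    Real.smoothTransition (B - L * p.1 - √(1 + (p.2 - a) ^ 2)) with hψdef
  have hψ : ContDiff ℝ ∞ ψ := by
    refine Real.smoothTransition.contDiff.comp (ContDiff.sub (by fun_prop) ?_)
    exact ContDiff.sqrt (by fun_prop) fun p => (hpos p.2).ne'
  have hψd := hψ.differentiable (by simp)
  have hB' : 0 < |a| + |B| + 1 := by positivity
  have hsup : ∀ t ∈ Icc 0 T, ∀ x, |a| + |B| + 1 ≤ |x| → ψ (t, x) = 0 := by
    intro t ht x hx
    refine Real.smoothTransition.zero_of_nonpos ?_
    have h1 := hroot x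
    have h2 := abs_sub_abs_le_abs_sub x a
    have h3 := le_abs_self B
    have h4 := mul_nonneg hL ht.1
    simp only
    linarith
  have key := h.integral_le hT hB' hψ (fun p => Real.smoothTransition.nonneg _)
    (fun p => Real.smoothTransition.le_one _) hsup (k := 0) fun t ht => by
      refine integral_nonpos fun x => ?_
      have d1 : HasDerivAt (fun s => B - L * s - √(1 + (x - a) ^ 2)) (-L) t := by
        simpa using (((hasDerivAt_id t).const_mul L).const_sub B).sub_const (√(1 + (x - a) ^ 2))
      have d2 : HasDerivAt (fun y => B - L * t - √(1 + (y - a) ^ 2))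
          (-((x - a) / √(1 + (x - a) ^ 2))) x := by
        have h1 : HasDerivAt (fun y => 1 + (y - a) ^ 2) (2 * (x - a)) x := by
          simpa using (((hasDerivAt_id x).sub_const a).pow 2).const_add 1
        have h2 := (h1.sqrt (hpos x).ne').const_sub (B - L * t)
        rwa [mul_div_mul_left _ _ (two_ne_zero)] at h2
      simp only [Pi.zero_apply]
      rw [fderiv_apply_fst (hψd _) (hasDerivAt_step_comp d1),
        fderiv_apply_snd (hψd _) (hasDerivAt_step_comp d2)]
      have hu := h.range t ht.1.le x
      have h3 : |(x - a) / √(1 + (x - a) ^ 2)| ≤ 1 := by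
        rw [abs_div, abs_of_nonneg (Real.sqrt_nonneg _)]
        exact div_le_one_of_le₀ (hroot x) (Real.sqrt_nonneg _)
      have h4 : -(q (u t x) * ((x - a) / √(1 + (x - a) ^ 2))) ≤ L * η (u t x) := by
        refine (neg_le_abs _).trans ?_
        rw [abs_mul]
        have := mul_le_mul (hq _ hu) h3 (abs_nonneg _) (mul_nonneg hL (hη _ hu))
        linarith
      have h5 := mul_le_mul_of_nonneg_left h4
        (stepDeriv_nonneg (B - L * t - √(1 + (x - a) ^ 2)))
      simp only
      linarith
  have hz : ∫ x, η (u₀ x) * ψ (0, x) = 0 := by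
    refine integral_eq_zero_of_ae (Eventually.of_forall fun x => ?_)
    by_cases hx : |x - a| < B
    · simp [h0 x hx]
    · have : ψ (0, x) = 0 := by
        refine Real.smoothTransition.zero_of_nonpos ?_
        have := hroot x
        simp only
        linarith
      simp [this]
  rw [hz] at key
  have hnn : ∀ x, 0 ≤ η (u T x) * ψ (T, x) := fun x =>
    mul_nonneg (hη _ (h.range T hT.le x)) (Real.smoothTransition.nonneg _)
  have hint : Integrable fun x => η (u T x) * ψ (T, x) := by
    have hC0 : 0 ≤ C := (abs_nonneg _).trans (hC _ (h.range_init 0)).1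
    refine integrable_of_bound_on_Icc (C := C) (B := |a| + |B| + 1)
      ((h.measurable_entropy.comp (h.measurable_slice T)).mul
        (hψ.continuous.comp (by fun_prop)).measurable) (fun x => ?_) fun x hx => ?_
    · rw [abs_mul, abs_of_nonneg (Real.smoothTransition.nonneg _)]
      exact (mul_le_mul (hC _ (h.range T hT.le x)).1 (Real.smoothTransition.le_one _)
        (Real.smoothTransition.nonneg _) hC0).trans_eq (mul_one C)
    · rw [hsup T (right_mem_Icc.2 hT.le) x hx, mul_zero]
  have h1 : ∫ x, η (u T x) * ψ (T, x) = 0 :=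
    le_antisymm (by linarith) (integral_nonneg hnn)
  filter_upwards [(integral_eq_zero_iff_of_nonneg hnn hint).1 h1] with x hx hxB
  refine (mul_eq_zero.1 hx).resolve_right (Real.smoothTransition.pos_of_pos ?_).ne'
  simp only
  linarith

end EntropyPair

theorem measurable_riemann (a b : ℝ) : Measurable (riemann a b) :=
  Measurable.ite measurableSet_Iic measurable_const measurable_const

theorem riemann_mem {a b : ℝ} {s : Set ℝ} (ha : a ∈ s) (hb : b ∈ s) (x : ℝ) :
    riemann a b x ∈ s := by
  unfold riemann
  split_ifs
  exacts [ha, hb]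

namespace IsEntropySolution

variable {M a b : ℝ} {u : ℝ → ℝ → ℝ} {f : ℝ → ℝ} {L : NNReal}
  (h : IsEntropySolution M f (riemann a b) u) (hf : LipschitzWith L f)
  (ha : a ∈ Icc 0 M) (hb : b ∈ Icc 0 M)
include h hf ha hb

theorem ae_le_of_riemann (hab : a ≤ b) {t : ℝ} (ht : 0 < t) : ∀ᵐ x, u t x ≤ b := by
  have hp := EntropyPair.posPart_sub h (measurable_riemann a b) (riemann_mem ha hb) hf hb
  have key : ∀ n : ℕ, _ := fun n : ℕ => hp.ae_eq_zero_in_cone (L := L) (a := 0) (B := n) L.2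
    (fun r _ => le_max_right _ _) (fun r _ => ?_) ht (fun x _ => ?_)
  · filter_upwards [ae_all_iff.2 key] with x hx
    obtain ⟨n, hn⟩ := exists_nat_gt (√(1 + (x - 0) ^ 2) + L * t)
    have := hx n (by linarith)
    simp only [max_eq_right_iff] at this
    linarith
  · have h1 := hf.dist_le_mul r b
    rw [Real.dist_eq, Real.dist_eq] at h1
    split_ifs with h2
    · rw [max_eq_left (by linarith)]
      rwa [abs_of_pos (sub_pos.2 h2)] at h1
    · rw [abs_zero]
      positivity
  · exact max_eq_right (by linarith [mem_Iic.1 (riemann_mem (s := Iic b) hab self_mem_Iic x)])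

theorem ae_ge_of_riemann (hab : a ≤ b) {t : ℝ} (ht : 0 < t) : ∀ᵐ x, a ≤ u t x := by
  have hp := EntropyPair.posPart_const_sub h (measurable_riemann a b) (riemann_mem ha hb) hf ha
  have key : ∀ n : ℕ, _ := fun n : ℕ => hp.ae_eq_zero_in_cone (L := L) (a := 0) (B := n) L.2
    (fun r _ => le_max_right _ _) (fun r _ => ?_) ht (fun x _ => ?_)
  · filter_upwards [ae_all_iff.2 key] with x hx
    obtain ⟨n, hn⟩ := exists_nat_gt (√(1 + (x - 0) ^ 2) + L * t)
    have := hx n (by linarith)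
    simp only [max_eq_right_iff] at this
    linarith
  · have h1 := hf.dist_le_mul a r
    rw [Real.dist_eq, Real.dist_eq] at h1
    split_ifs with h2
    · rw [max_eq_left (by linarith)]
      rwa [abs_of_pos (sub_pos.2 h2)] at h1
    · rw [abs_zero]
      positivity
  · exact max_eq_right (by linarith [mem_Ici.1 (riemann_mem (s := Ici a) self_mem_Ici hab x)])

/-- Values in a neighbourhood of `x` at time `0` are not seen at `(x,t)` when `|x| > Lt`. -/
theorem ae_eq_left_and_right {t : ℝ} (ht : 0 < t) :
    ∀ᵐ x, (x < -(L * t) → u t x = a) ∧ (L * t < x → u t x = b) := by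
  have hLt : 0 ≤ L * t := mul_nonneg L.2 ht.le
  have hq : ∀ c r : ℝ, |Real.sign (r - c) * (f r - f c)| ≤ L * |r - c| := by
    intro c r
    have h1 := hf.dist_le_mul r c
    rw [Real.dist_eq, Real.dist_eq] at h1
    rw [abs_mul]
    exact (mul_le_of_le_one_left (abs_nonneg _) (abs_sign_le_one _)).trans h1
  have hex : ∀ x : ℝ, L * t < x → ∃ n : ℕ, √(1 + (x - n) ^ 2) < n - L * t := by
    intro x hx
    obtain ⟨n, hn⟩ := exists_nat_gt ((1 + x ^ 2) / (2 * (x - L * t)) + L * t)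
    refine ⟨n, ?_⟩
    have h1 : (1 + x ^ 2) / (2 * (x - L * t)) < n - L * t := by linarith
    rw [div_lt_iff₀ (by linarith)] at h1
    have h2 : (0 : ℝ) < n - L * t := by
      have : 0 ≤ (1 + x ^ 2) / (2 * (x - L * t)) := div_nonneg (by positivity) (by linarith)
      linarith
    rw [Real.sqrt_lt' h2]
    nlinarith
  have keyl : ∀ n : ℕ, _ := fun n : ℕ =>
    (EntropyPair.kruzkov h (measurable_riemann a b) (riemann_mem ha hb) hf
      ha).ae_eq_zero_in_cone (L := L) (a := -n) (B := n) L.2 (fun r _ => abs_nonneg _)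
      (fun r _ => hq a r) ht (fun x hx => by
        have : x ≤ 0 := by linarith [(abs_lt.1 hx).2]
        simp [riemann, this])
  have keyr : ∀ n : ℕ, _ := fun n : ℕ =>
    (EntropyPair.kruzkov h (measurable_riemann a b) (riemann_mem ha hb) hf
      hb).ae_eq_zero_in_cone (L := L) (a := n) (B := n) L.2 (fun r _ => abs_nonneg _)
      (fun r _ => hq b r) ht (fun x hx => by
        have : ¬ x ≤ 0 := by linarith [(abs_lt.1 hx).1]
        simp [riemann, this])
  filter_upwards [ae_all_iff.2 keyl, ae_all_iff.2 keyr] with x hl hr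
  constructor
  · intro hx
    obtain ⟨n, hn⟩ := hex (-x) (by linarith)
    have := hl n (by convert! hn using 2; ring)
    exact sub_eq_zero.1 (abs_eq_zero.1 this)
  · intro hx
    obtain ⟨n, hn⟩ := hex x hx
    exact sub_eq_zero.1 (abs_eq_zero.1 (hr n hn))

end IsEntropySolution

/-! ### Moving fronts -/

/-- The weight that rises from `0` to `1` on `[-R - 1, -R]` and falls back to `0` on
`[m, m + δ]`. -/
noncomputable def plateau (R m δ x : ℝ) : ℝ :=
  Real.smoothTransition (x + (R + 1)) * (1 - Real.smoothTransition ((x - m) / δ))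

theorem plateau_nonneg (R m δ x : ℝ) : 0 ≤ plateau R m δ x :=
  mul_nonneg (Real.smoothTransition.nonneg _) (sub_nonneg.2 (Real.smoothTransition.le_one _))

theorem plateau_le_one (R m δ x : ℝ) : plateau R m δ x ≤ 1 :=
  mul_le_one₀ (Real.smoothTransition.le_one _) (sub_nonneg.2 (Real.smoothTransition.le_one _))
    (sub_le_self _ (Real.smoothTransition.nonneg _))

theorem plateau_of_le {R m δ x : ℝ} (hδ : 0 < δ) (hx : x ≤ m) :
    plateau R m δ x = Real.smoothTransition (x + (R + 1)) := by
  have h0 : (x - m) / δ ≤ 0 := div_nonpos_of_nonpos_of_nonneg (by linarith) hδ.le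
  rw [plateau, Real.smoothTransition.zero_of_nonpos h0, sub_zero, mul_one]

theorem plateau_of_ge {R m δ x : ℝ} (hδ : 0 < δ) (hx : m + δ ≤ x) : plateau R m δ x = 0 := by
  have h1 : 1 ≤ (x - m) / δ := by
    rw [le_div_iff₀ hδ]
    linarith
  rw [plateau, Real.smoothTransition.one_of_one_le h1, sub_self, mul_zero]

theorem plateau_of_le_left {R m δ x : ℝ} (hx : x ≤ -(R + 1)) : plateau R m δ x = 0 := by
  rw [plateau, Real.smoothTransition.zero_of_nonpos (by linarith), zero_mul]

theorem continuous_plateau (R m δ : ℝ) : Continuous (plateau R m δ) :=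
  (Real.smoothTransition.continuous.comp (by fun_prop)).mul
    (continuous_const.sub (Real.smoothTransition.continuous.comp (by fun_prop)))

theorem integrable_mul_plateau {R m δ C : ℝ} (hδ : 0 < δ) {g : ℝ → ℝ} (hg : Measurable g)
    (hC : ∀ x, |g x| ≤ C) : Integrable fun x => g x * plateau R m δ x := by
  refine integrable_mul_of_bound_on_support hg ?_ fun x _ => hC x
  refine (continuous_plateau R m δ).integrable_of_hasCompactSupport
    (HasCompactSupport.intro (isCompact_Icc (a := -(R + 1)) (b := m + δ)) fun x hx => ?_)
  by_contra h0
  refine hx ⟨?_, ?_⟩ <;> by_contra! h1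
  · exact h0 (plateau_of_le_left h1.le)
  · exact h0 (plateau_of_ge hδ h1.le)

namespace EntropyPair

variable {M : ℝ} {u₀ : ℝ → ℝ} {u : ℝ → ℝ → ℝ} {η q : ℝ → ℝ}

/-- The entropy inequality on `[0,1]` against a weight whose right edge moves at speed `y`. The
flux through the left edge is at most `A`, and that through the moving edge at most `H`. -/
theorem integral_plateau_le (h : EntropyPair M u₀ u η q) {R m y δ A H : ℝ} (hδ : 0 < δ)
    (hm : -R ≤ m) (hmy : -R ≤ m + y)
    (hleft : ∀ t ∈ Ioo (0 : ℝ) 1, ∀ᵐ x, x < -R → q (u t x) ≤ A)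
    (hright : ∀ t ∈ Ioo (0 : ℝ) 1, ∀ᵐ x, m + y * t < x → y * η (u t x) - q (u t x) ≤ H) :
    ∫ x, η (u 1 x) * plateau R (m + y) δ x ≤ (∫ x, η (u₀ x) * plateau R m δ x) + (A + H) := by
  obtain ⟨C, hC⟩ := h.exists_bound
  set ψ : ℝ × ℝ → ℝ := fun p => plateau R (m + y * p.1) δ p.2 with hψdef
  have hψ : ContDiff ℝ ∞ ψ :=
    (Real.smoothTransition.contDiff.comp (by fun_prop)).mul
      (contDiff_const.sub (Real.smoothTransition.contDiff.comp (by fun_prop)))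
  have hψd := hψ.differentiable (by simp)
  have hmt : ∀ t ∈ Icc (0 : ℝ) 1, -R ≤ m + y * t ∧ y * t ≤ |y| := by
    intro t ht
    constructor
    · nlinarith [ht.1, ht.2]
    · calc y * t ≤ |y * t| := le_abs_self _
        _ = |y| * t := by rw [abs_mul, abs_of_nonneg ht.1]
        _ ≤ |y| := mul_le_of_le_one_right (abs_nonneg _) ht.2
  have key := h.integral_le (ψ := ψ) (T := 1) (B := |R| + 1 + |m| + |y| + δ) (k := A + H)
    one_pos (by positivity) hψ (fun p => plateau_nonneg _ _ _ _) (fun p => plateau_le_one _ _ _ _)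
    ?_ ?_
  · simpa [hψdef] using key
  · intro t ht x hx
    have h1 := le_abs_self R
    have h2 := le_abs_self m
    have h3 := abs_nonneg y
    have h4 := abs_nonneg R
    have h5 := abs_nonneg m
    rcases le_abs'.1 hx with h6 | h6
    · exact plateau_of_le_left (by linarith)
    · exact plateau_of_ge hδ (by linarith [(hmt t ht).2])
  · intro t ht
    have ht' := Ioo_subset_Icc_self ht
    set p1 : ℝ → ℝ := fun x => stepDeriv (x + (R + 1)) with hp1
    set p2 : ℝ → ℝ := fun x => stepDeriv ((x - (m + y * t)) / δ) / δ with hp2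
    have ip1 : Integrable p1 := integrable_stepDeriv.comp_add_right (R + 1)
    have ip2 : Integrable p2 := integrable_stepDeriv_scaled hδ _
    have e : ∀ x, η (u t x) * fderiv ℝ ψ (t, x) (1, 0) + q (u t x) * fderiv ℝ ψ (t, x) (0, 1) =
        q (u t x) * p1 x + (y * η (u t x) - q (u t x)) * p2 x := by
      intro x
      have d1 : HasDerivAt (fun s => (x - (m + y * s)) / δ) (-y / δ) t := by
        have := ((((hasDerivAt_id t).const_mul y).const_add m).const_sub x).div_const δ
        simpa using this
      have d2 : HasDerivAt (fun z => (z - (m + y * t)) / δ) (1 / δ) x :=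
        ((hasDerivAt_id x).sub_const _).div_const δ
      have d3 : HasDerivAt (fun z => z + (R + 1)) 1 x := (hasDerivAt_id x).add_const _
      rw [fderiv_apply_fst (hψd _) (((hasDerivAt_step_comp d1).const_sub 1).const_mul
          (Real.smoothTransition (x + (R + 1)))),
        fderiv_apply_snd (hψd _)
          ((hasDerivAt_step_comp d3).mul ((hasDerivAt_step_comp d2).const_sub 1))]
      simp only [hp1, hp2]
      -- at each point one of the two edges is flat
      rcases le_total x (m + y * t) with hx | hx
      · have h0 : (x - (m + y * t)) / δ ≤ 0 :=
          div_nonpos_of_nonpos_of_nonneg (by linarith) hδ.le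
        rw [stepDeriv_eq_zero (Or.inl h0), Real.smoothTransition.zero_of_nonpos h0]
        ring
      · have h1 : 1 ≤ x + (R + 1) := by linarith [(hmt t ht').1]
        rw [stepDeriv_eq_zero (Or.inr h1), Real.smoothTransition.one_of_one_le h1]
        ring
    have hqm : Measurable fun x => q (u t x) := h.measurable_flux.comp (h.measurable_slice t)
    have hηm : Measurable fun x => η (u t x) := h.measurable_entropy.comp (h.measurable_slice t)
    have i1 : Integrable fun x => q (u t x) * p1 x :=
      integrable_mul_of_bound_on_support hqm ip1 fun x _ => (hC _ (h.range t ht.1.le x)).2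
    have i2 : Integrable fun x => (y * η (u t x) - q (u t x)) * p2 x := by
      refine integrable_mul_of_bound_on_support (C := |y| * C + C) ((hηm.const_mul y).sub hqm) ip2
        fun x _ => ?_
      have hc := hC _ (h.range t ht.1.le x)
      refine (abs_sub _ _).trans (add_le_add ?_ hc.2)
      rw [abs_mul]
      exact mul_le_mul_of_nonneg_left hc.1 (abs_nonneg y)
    simp only [e]
    rw [integral_add i1 i2]
    refine add_le_add ?_ ?_
    · calc ∫ x, q (u t x) * p1 x ≤ ∫ x, A * p1 x := by
            refine integral_mono_ae i1 (ip1.const_mul A) ?_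
            filter_upwards [hleft t ht] with x hx
            rcases lt_or_ge x (-R) with h1 | h1
            · exact mul_le_mul_of_nonneg_right (hx h1) (stepDeriv_nonneg _)
            · simp [hp1, stepDeriv_eq_zero (Or.inr (by linarith : 1 ≤ x + (R + 1)))]
        _ = A := by
            rw [integral_const_mul, integral_add_right_eq_self stepDeriv, integral_stepDeriv,
              mul_one]
    · calc ∫ x, (y * η (u t x) - q (u t x)) * p2 x ≤ ∫ x, H * p2 x := by
            refine integral_mono_ae i2 (ip2.const_mul H) ?_
            filter_upwards [hright t ht] with x hx
            rcases lt_or_ge (m + y * t) x with h1 | h1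
            · exact mul_le_mul_of_nonneg_right (hx h1) (div_nonneg (stepDeriv_nonneg _) hδ.le)
            · have h0 : (x - (m + y * t)) / δ ≤ 0 :=
                div_nonpos_of_nonpos_of_nonneg (by linarith) hδ.le
              simp [hp2, stepDeriv_eq_zero (Or.inl h0)]
        _ = H := by
            rw [integral_const_mul, integral_stepDeriv_scaled hδ, mul_one]

end EntropyPair

/-! ### The Hopf formula for Riemann data -/

/-- The primitive of `w κ`, where the weight `κ` is `0` left of `-R - 1` and `1` right of `-R`. -/
noncomputable def cutPrimitive (R : ℝ) (w : ℝ → ℝ) (x : ℝ) : ℝ :=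
  ∫ y in (-(R + 1))..x, w y * Real.smoothTransition (y + (R + 1))

theorem intervalIntegrable_cut {w : ℝ → ℝ} {C : ℝ} (hw : Measurable w) (hC : ∀ x, |w x| ≤ C)
    (R a b : ℝ) :
    IntervalIntegrable (fun y => w y * Real.smoothTransition (y + (R + 1))) volume a b := by
  have hC0 : 0 ≤ C := (abs_nonneg _).trans (hC 0)
  refine (intervalIntegrable_const (c := C)).mono_fun
    (hw.mul (Real.smoothTransition.continuous.comp (by fun_prop)).measurable).aestronglyMeasurable
    (Eventually.of_forall fun x => ?_)
  simp only [Real.norm_eq_abs]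
  rw [abs_mul, abs_of_nonneg (Real.smoothTransition.nonneg _), abs_of_nonneg hC0]
  exact (mul_le_mul (hC x) (Real.smoothTransition.le_one _) (Real.smoothTransition.nonneg _)
    hC0).trans_eq (mul_one C)

theorem cutPrimitive_const {R x : ℝ} (hR : 0 ≤ R) (hx : -R ≤ x) (c : ℝ) :
    cutPrimitive R (fun _ => c) x = cutPrimitive R (fun _ => c) 0 + c * x := by
  have hi := fun a b => intervalIntegrable_cut (w := fun _ => c) measurable_const
    (fun _ => le_rfl) R a b
  unfold cutPrimitive
  rw [← intervalIntegral.integral_add_adjacent_intervals (hi _ 0) (hi 0 x)]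
  congr 1
  have : EqOn (fun y => c * Real.smoothTransition (y + (R + 1))) (fun _ => c) (uIcc 0 x) := by
    intro y hy
    have h1 : -R ≤ y := (le_min (by linarith) hx).trans hy.1
    simp [Real.smoothTransition.one_of_one_le (by linarith : 1 ≤ y + (R + 1))]
  rw [intervalIntegral.integral_congr this]
  simp [mul_comm]

theorem cutPrimitive_sub {w : ℝ → ℝ} {C : ℝ} (hw : Measurable w) (hC : ∀ x, |w x| ≤ C)
    (R c x : ℝ) : cutPrimitive R (fun y => c - w y) x =
      cutPrimitive R (fun _ => c) x - cutPrimitive R w x := by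
  unfold cutPrimitive
  simp only [sub_mul]
  exact intervalIntegral.integral_sub
    (intervalIntegrable_cut measurable_const (fun _ => le_rfl) _ _ _)
    (intervalIntegrable_cut hw hC _ _ _)

/-- Weighted integrals of a nonnegative function dominate the primitive. -/
theorem cutPrimitive_le_integral_plateau {R m δ x C : ℝ} (hδ : 0 < δ) (hx : -(R + 1) ≤ x)
    (hxm : x ≤ m) {w g : ℝ → ℝ} (hw : Measurable w) (hwC : ∀ x, |w x| ≤ C) (hg : Measurable g)
    (hgC : ∀ x, |g x| ≤ C) (hg0 : ∀ x, 0 ≤ g x) (hwg : ∀ x, w x ≤ g x) :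
    cutPrimitive R w x ≤ ∫ y, g y * plateau R m δ y := by
  have hi := integrable_mul_plateau (R := R) (m := m) hδ hg hgC
  rw [cutPrimitive, intervalIntegral.integral_of_le hx]
  calc ∫ y in Ioc (-(R + 1)) x, w y * Real.smoothTransition (y + (R + 1))
      ≤ ∫ y in Ioc (-(R + 1)) x, g y * plateau R m δ y := by
        refine setIntegral_mono_on ((intervalIntegrable_iff_integrableOn_Ioc_of_le hx).1
          (intervalIntegrable_cut hw hwC _ _ _)) hi.integrableOn measurableSet_Ioc fun y hy => ?_
        rw [plateau_of_le hδ (hy.2.trans hxm)]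
        exact mul_le_mul_of_nonneg_right (hwg y) (Real.smoothTransition.nonneg _)
    _ ≤ ∫ y, g y * plateau R m δ y :=
        setIntegral_le_integral hi
          (Eventually.of_forall fun y => mul_nonneg (hg0 y) (plateau_nonneg _ _ _ _))

/-- The integral of `c` times the weight, with an error of at most `d δ` from a right end with
values at most `d` past `0`. -/
theorem integral_plateau_le_cutPrimitive {R m δ c d e C : ℝ} (hR : 0 ≤ R) (hδ : 0 < δ)
    (hm : 0 ≤ m) {g : ℝ → ℝ} (hg : Measurable g) (hgC : ∀ x, |g x| ≤ C)
    (hleft : ∀ x ≤ 0, g x ≤ c) (hright : ∀ x, 0 < x → g x ≤ d) (hd : 0 ≤ d)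
    (he : d * (m + δ) ≤ e) :
    ∫ y, g y * plateau R m δ y ≤ cutPrimitive R (fun _ => c) 0 + e := by
  have h1 : IntegrableOn (fun y => c * Real.smoothTransition (y + (R + 1)))
      (Ioc (-(R + 1)) 0) :=
    (intervalIntegrable_iff_integrableOn_Ioc_of_le (by linarith)).1
      (intervalIntegrable_cut (w := fun _ => c) measurable_const (fun _ => le_rfl) _ _ _)
  have h2 : IntegrableOn (fun _ : ℝ => d) (Ioc 0 (m + δ)) := by simp
  have j1 := (integrable_indicator_iff measurableSet_Ioc).2 h1
  have j2 := (integrable_indicator_iff measurableSet_Ioc).2 h2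
  calc ∫ y, g y * plateau R m δ y
      ≤ ∫ y, ((Ioc (-(R + 1)) 0).indicator
          (fun y => c * Real.smoothTransition (y + (R + 1))) y +
          (Ioc 0 (m + δ)).indicator (fun _ => d) y) := by
        refine integral_mono (integrable_mul_plateau hδ hg hgC) (j1.add j2) fun y => ?_
        rcases le_or_gt y 0 with hy | hy
        · rw [indicator_of_notMem (s := Ioc 0 (m + δ)) fun h => hy.not_gt h.1, add_zero]
          by_cases hy' : -(R + 1) < y
          · rw [indicator_of_mem (show y ∈ Ioc (-(R + 1)) 0 from ⟨hy', hy⟩),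
              plateau_of_le hδ (hy.trans hm)]
            exact mul_le_mul_of_nonneg_right (hleft y hy) (Real.smoothTransition.nonneg _)
          · rw [indicator_of_notMem fun h => hy' h.1, plateau_of_le_left (not_lt.1 hy'), mul_zero]
        · rw [indicator_of_notMem (s := Ioc (-(R + 1)) 0) fun h => hy.not_ge h.2, zero_add]
          by_cases hy' : y ≤ m + δ
          · rw [indicator_of_mem (show y ∈ Ioc 0 (m + δ) from ⟨hy, hy'⟩)]
            exact (mul_le_mul_of_nonneg_right (hright y hy) (plateau_nonneg _ _ _ _)).trans
              (mul_le_of_le_one_right hd (plateau_le_one _ _ _ _))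
          · rw [indicator_of_notMem fun h => hy' h.2, plateau_of_ge hδ (not_le.1 hy').le, mul_zero]
    _ = cutPrimitive R (fun _ => c) 0 + d * (m + δ) := by
        rw [integral_add j1 j2, integral_indicator measurableSet_Ioc,
          integral_indicator measurableSet_Ioc, cutPrimitive,
          intervalIntegral.integral_of_le (by linarith)]
        simp [mul_comm, (by linarith : 0 ≤ m + δ)]
    _ ≤ _ := by linarith

namespace IsEntropySolution

variable {M a b : ℝ} {u : ℝ → ℝ → ℝ} {f : ℝ → ℝ} {L : NNReal}
  (h : IsEntropySolution M f (riemann a b) u) (hf : LipschitzWith L f)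
  (ha : a ∈ Icc 0 M) (hb : b ∈ Icc 0 M)
include h hf ha hb

/-- Comparison with the constant solution `c`: the potential lies above the affine function
`c x - f(c)`. -/
theorem le_cutPrimitive {R x c : ℝ} (hR : L ≤ R) (hx : x ∈ Icc (-R) R) (hc : c ∈ Icc a b) :
    c * x - f c ≤ cutPrimitive R (u 1) x - cutPrimitive R (fun _ => a) 0 - f a := by
  have hR0 : 0 ≤ R := L.2.trans hR
  have hcM : c ∈ Icc 0 M := ⟨ha.1.trans hc.1, hc.2.trans hb.2⟩
  have hp := EntropyPair.posPart_const_sub h (measurable_riemann a b) (riemann_mem ha hb) hf hcM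
  have hLt : ∀ t ∈ Ioo (0 : ℝ) 1, (L : ℝ) * t ≤ R := fun t ht =>
    (mul_le_of_le_one_right L.2 ht.2.le).trans hR
  have key := hp.integral_plateau_le (R := R) (m := R) (y := 0) (δ := 1) (A := f c - f a) (H := 0)
    one_pos (by linarith) (by linarith) (fun t ht => by
      filter_upwards [h.ae_eq_left_and_right hf ha hb ht.1] with x hx hxR
      rw [hx.1 (by linarith [hLt t ht])]
      split_ifs with h1
      · exact le_rfl
      · rw [le_antisymm hc.1 (not_lt.1 h1)]
        simp) (fun t ht => by
      filter_upwards [h.ae_eq_left_and_right hf ha hb ht.1] with x hx hxR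
      rw [hx.2 (by linarith [hLt t ht]), if_neg (not_lt.2 hc.2)]
      simp)
  rw [add_zero, add_zero] at key
  have hum := hp.measurable_slice 1
  have hu := h.range 1 zero_le_one
  have hM : 0 ≤ M := ha.1.trans ha.2
  have b1 : ∀ r ∈ Icc 0 M, |c - r| ≤ M := fun r hr =>
    abs_le.2 ⟨by linarith [hcM.1, hr.2], by linarith [hcM.2, hr.1]⟩
  have b2 : ∀ r ∈ Icc 0 M, |max (c - r) 0| ≤ M := fun r hr => by
    rw [abs_of_nonneg (le_max_right _ _)]
    exact max_le ((le_abs_self _).trans (b1 r hr)) hM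
  have l1 := cutPrimitive_le_integral_plateau (R := R) (m := R) (δ := 1) (x := x) (C := M) one_pos
    (by linarith [hx.1]) hx.2 (hum.const_sub c) (fun y => b1 _ (hu y))
    ((hum.const_sub c).max measurable_const) (fun y => b2 _ (hu y)) (fun y => le_max_right _ _)
    (fun y => le_max_left _ _)
  have l2 := integral_plateau_le_cutPrimitive (R := R) (m := R) (δ := 1) (c := c - a) (d := 0)
    (e := 0) (C := M) hR0 one_pos hR0
    (((measurable_riemann a b).const_sub c).max measurable_const)
    (fun y => b2 _ (riemann_mem ha hb y))
    (fun y hy => by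
      simp only [riemann, if_pos hy]
      rw [max_eq_left (by linarith [hc.1])])
    (fun y hy => by
      simp only [riemann, if_neg hy.not_ge]
      rw [max_eq_right (by linarith [hc.2])]) le_rfl (by simp)
  have e1 := cutPrimitive_sub hum (C := M) (fun y => abs_le.2 ⟨by linarith [(hu y).1], (hu y).2⟩)
    R c x
  have e2 := cutPrimitive_sub (w := fun _ => a) measurable_const (fun _ => le_rfl) R c 0
  have e3 := cutPrimitive_const hR0 hx.1 c
  linarith

/-- Conservation along the ray from the origin to `(x,1)`: the flux through it is at most the
maximum of `c x - f(c)`. -/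
theorem cutPrimitive_le (hab : a ≤ b) {R x H : ℝ} (hR : L ≤ R) (hx : -R ≤ x)
    (hH : ∀ c ∈ Icc a b, c * x - f c ≤ H) :
    cutPrimitive R (u 1) x - cutPrimitive R (fun _ => a) 0 - f a ≤ H := by
  have hR0 : 0 ≤ R := L.2.trans hR
  have hp := EntropyPair.conservation h (measurable_riemann a b) (riemann_mem ha hb) hf
  have hLt : ∀ t ∈ Ioo (0 : ℝ) 1, (L : ℝ) * t ≤ R := fun t ht =>
    (mul_le_of_le_one_right L.2 ht.2.le).trans hR
  have hum := hp.measurable_slice 1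
  have hu := h.range 1 zero_le_one
  have b1 : ∀ r ∈ Icc 0 M, |r| ≤ M := fun r hr => abs_le.2 ⟨by linarith [hr.1, hr.2], hr.2⟩
  refine le_of_forall_pos_le_add fun ε hε => ?_
  obtain ⟨δ, hδ, hδε⟩ : ∃ δ, 0 < δ ∧ b * δ ≤ ε := by
    refine ⟨ε / (b + 1), div_pos hε (by linarith [hb.1]), ?_⟩
    rw [mul_div_assoc', div_le_iff₀ (by linarith [hb.1])]
    nlinarith [hb.1]
  have key := hp.integral_plateau_le (R := R) (m := 0) (y := x) (δ := δ) (A := f a - f 0)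
    (H := H + f 0) hδ (by linarith) (by linarith) (fun t ht => by
      filter_upwards [h.ae_eq_left_and_right hf ha hb ht.1] with z hz hzR
      rw [hz.1 (by linarith [hLt t ht])]) (fun t ht => by
      filter_upwards [h.ae_le_of_riemann hf ha hb hab ht.1,
        h.ae_ge_of_riemann hf ha hb hab ht.1] with z hz1 hz2 _
      linarith [hH _ ⟨hz2, hz1⟩])
  rw [zero_add] at key
  have l1 := cutPrimitive_le_integral_plateau (R := R) (m := x) (x := x) (C := M) hδ
    (by linarith) le_rfl hum (fun y => b1 _ (hu y)) hum (fun y => b1 _ (hu y))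
    (fun y => (hu y).1) (fun y => le_rfl)
  have l2 := integral_plateau_le_cutPrimitive (R := R) (m := 0) (c := a) (d := b)
    (e := ε) (C := M) hR0 hδ le_rfl (measurable_riemann a b)
    (fun y => b1 _ (riemann_mem ha hb y)) (fun y hy => by simp [riemann, hy])
    (fun y hy => by simp [riemann, hy.not_ge]) hb.1 (by simpa using hδε)
  linarith

end IsEntropySolution

/-- The points of `[a,b]` at which `c ↦ c v - f(c)` is maximal on `[a,b]`. -/
def maximizers (f : ℝ → ℝ) (a b v : ℝ) : Set ℝ :=
  {c | c ∈ Icc a b ∧ ∀ c' ∈ Icc a b, c' * v - f c' ≤ c * v - f c}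

theorem maximizers_congr {f g : ℝ → ℝ} {a b : ℝ} (h : EqOn f g (Icc a b)) (v : ℝ) :
    maximizers f a b v = maximizers g a b v := by
  ext c
  refine and_congr_right fun hc => forall₂_congr fun c' hc' => ?_
  rw [h hc, h hc']

theorem maximizers_nonempty {f : ℝ → ℝ} {a b : ℝ} (hab : a ≤ b) (hf : ContinuousOn f (Icc a b))
    (v : ℝ) : (maximizers f a b v).Nonempty := by
  obtain ⟨c, hc, hmax⟩ := isCompact_Icc.exists_isMaxOn (nonempty_Icc.2 hab)
    (f := fun c => c * v - f c) (by fun_prop)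
  exact ⟨c, hc, fun c' hc' => hmax hc'⟩

/-- By the Hopf formula the potential at time `1` is `max (c x - f(c))` over `c ∈ [a,b]`, up to a
constant; where it is differentiable its slope is a maximizer. -/
theorem IsEntropySolution.ae_mem_maximizers_of_lipschitzWith {M a b : ℝ} {u : ℝ → ℝ → ℝ}
    {f : ℝ → ℝ} {L : NNReal} (h : IsEntropySolution M f (riemann a b) u) (hf : LipschitzWith L f)
    (ha : a ∈ Icc 0 M) (hb : b ∈ Icc 0 M) (hab : a ≤ b) :
    ∀ᵐ x, u 1 x ∈ maximizers f a b x := by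
  have hum : Measurable (u 1) := h.measurable.comp (measurable_const.prodMk measurable_id)
  have hu := h.range 1 zero_le_one
  have hder : ∀ n : ℕ, ∀ᵐ x, ∀ c, HasDerivAt (fun x => ∫ y in c..x,
      u 1 y * Real.smoothTransition (y + (n + 1))) (u 1 x * Real.smoothTransition (x + (n + 1)))
      x := by
    intro n
    refine LocallyIntegrable.ae_hasDerivAt_integral ?_
    refine (locallyIntegrable_const M).mono
      (hum.mul
        (Real.smoothTransition.continuous.comp (by fun_prop)).measurable).aestronglyMeasurable
      (Eventually.of_forall fun x => ?_)
    rw [norm_mul, Real.norm_of_nonneg (hu x).1,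
      Real.norm_of_nonneg (Real.smoothTransition.nonneg _),
      Real.norm_of_nonneg (ha.1.trans ha.2)]
    exact (mul_le_of_le_one_right (hu x).1 (Real.smoothTransition.le_one _)).trans (hu x).2
  filter_upwards [ae_all_iff.2 hder] with x hx
  obtain ⟨n, hn⟩ := exists_nat_gt (max (L : ℝ) |x|)
  have hLn : (L : ℝ) ≤ n := (le_max_left _ _).trans hn.le
  have hxn := abs_lt.1 ((le_max_right _ _).trans_lt hn)
  have hd : HasDerivAt (cutPrimitive n (u 1)) (u 1 x) x := by
    have := hx n (-(n + 1))
    rwa [Real.smoothTransition.one_of_one_le (by linarith [hxn.1]), mul_one] at this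
  obtain ⟨c, hc⟩ := maximizers_nonempty hab hf.continuous.continuousOn x
  have hmin : IsLocalMin (fun y => cutPrimitive n (u 1) y - c * y) x := by
    filter_upwards [Ioo_mem_nhds hxn.1 hxn.2] with y hy
    have h1 := h.le_cutPrimitive hf ha hb hLn (Ioo_subset_Icc_self hy) hc.1
    have h2 := h.cutPrimitive_le hf ha hb hab hLn hxn.1.le hc.2
    linarith
  have hzero := hmin.hasDerivAt_eq_zero (hd.sub ((hasDerivAt_id x).const_mul c))
  have : u 1 x = c := by linarith
  rwa [this]

/-! ### Lipschitz fluxes on an interval, and decreasing data -/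

namespace IsEntropySolution

variable {M a b : ℝ} {u₀ : ℝ → ℝ} {u : ℝ → ℝ → ℝ} {f g : ℝ → ℝ}

theorem congr_flux (h : IsEntropySolution M f u₀ u) (hfg : EqOn f g (Icc 0 M)) :
    IsEntropySolution M g u₀ u := by
  refine { h with entropy := fun c hc φ hφ hφc hφs hφ0 => ?_ }
  convert! h.entropy c hc φ hφ hφc hφs hφ0 using 3 with p
  by_cases hp : 0 < p.1
  · rw [hfg hc, hfg (h.range _ hp.le _)]
  · have : fderiv ℝ φ p = 0 := by
      by_contra h0
      exact hp (hφs (support_fderiv_subset ℝ h0))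
    simp [this]

/-- The exchange `r ↦ M - r` of particles and holes. -/
theorem reflect (h : IsEntropySolution M f u₀ u) :
    IsEntropySolution M (fun r => -f (M - r)) (fun x => M - u₀ x) (fun t x => M - u t x) := by
  have e : ∀ r s : ℝ, |M - r - (M - s)| = |r - s| := fun r s => by
    rw [← abs_neg]
    ring_nf
  refine ⟨h.measurable.const_sub M, fun t ht x => ?_, ?_, fun a b hab => ?_,
    fun a b hab s hs => ?_⟩
  · have := h.range t ht x
    exact ⟨by linarith [this.2], by linarith [this.1]⟩
  · intro c hc φ hφ hφc hφs hφ0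
    convert! h.entropy (M - c) ⟨by linarith [hc.2], by linarith [hc.1]⟩ φ hφ hφc hφs hφ0
      using 3 with p
    have e1 : M - u p.1 p.2 - c = -(u p.1 p.2 - (M - c)) := by ring
    rw [e1, abs_neg, Real.sign_neg, sub_sub_cancel]
    ring
  · simpa only [e] using h.initial a b hab
  · simpa only [e] using h.continuous a b hab s hs

theorem ae_mem_maximizers {K : NNReal} (h : IsEntropySolution M f (riemann a b) u)
    (hf : LipschitzOnWith K f (Icc 0 M)) (ha : a ∈ Icc 0 M) (hb : b ∈ Icc 0 M) (hab : a ≤ b) :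
    ∀ᵐ x, u 1 x ∈ maximizers f a b x := by
  obtain ⟨g, hg, hfg⟩ := hf.extend_real
  have hsub : Icc a b ⊆ Icc 0 M := Icc_subset_Icc ha.1 hb.2
  simp only [maximizers_congr (hfg.mono hsub)]
  exact (h.congr_flux hfg).ae_mem_maximizers_of_lipschitzWith hg ha hb hab

/-- For decreasing data `u 1 x` maximizes `c ↦ f(c) - c x` on `[b,a]`. -/
theorem ae_mem_maximizers_neg {K : NNReal} (h : IsEntropySolution M f (riemann a b) u)
    (hf : LipschitzOnWith K f (Icc 0 M)) (ha : a ∈ Icc 0 M) (hb : b ∈ Icc 0 M) (hba : b ≤ a) :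
    ∀ᵐ x, u 1 x ∈ maximizers (-f) b a (-x) := by
  have h' := h.reflect
  have e : (fun x => M - riemann a b x) = riemann (M - a) (M - b) := by
    funext x
    unfold riemann
    split_ifs <;> rfl
  rw [e] at h'
  have hmaps : ∀ r ∈ Icc 0 M, M - r ∈ Icc 0 M := fun r hr =>
    ⟨by linarith [hr.2], by linarith [hr.1]⟩
  have hf' : LipschitzOnWith K (fun r => -f (M - r)) (Icc 0 M) := by
    refine LipschitzOnWith.of_dist_le_mul fun x hx y hy => ?_
    rw [dist_neg_neg]
    refine (hf.dist_le_mul _ (hmaps x hx) _ (hmaps y hy)).trans_eq ?_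
    rw [dist_sub_left]
  filter_upwards [h'.ae_mem_maximizers hf' (hmaps a ha) (hmaps b hb) (by linarith)] with x hx
  refine ⟨⟨by linarith [hx.1.2], by linarith [hx.1.1]⟩, fun c hc => ?_⟩
  have := hx.2 (M - c) ⟨by linarith [hc.2], by linarith [hc.1]⟩
  simp only [sub_sub_cancel] at this
  simp only [Pi.neg_apply]
  linarith

end IsEntropySolution

/-! ### Traces -/

theorem neBot_nhdsLT_inf_ae (v : ℝ) : NeBot (𝓝[<] v ⊓ ae (volume : Measure ℝ)) := by
  rw [inf_neBot_iff]
  intro s hs t ht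
  obtain ⟨l, hl, hls⟩ := (mem_nhdsLT_iff_exists_Ioo_subset).1 hs
  by_contra hne
  rw [not_nonempty_iff_eq_empty, ← disjoint_iff_inter_eq_empty] at hne
  have h1 : volume (Ioo l v) ≤ volume tᶜ :=
    measure_mono (hls.trans hne.subset_compl_right)
  rw [mem_ae_iff.1 ht, Real.volume_Ioo] at h1
  simp only [nonpos_iff_eq_zero, ENNReal.ofReal_eq_zero] at h1
  linarith [mem_Iio.1 hl]

theorem neBot_nhdsGT_inf_ae (v : ℝ) : NeBot (𝓝[>] v ⊓ ae (volume : Measure ℝ)) := by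
  rw [inf_neBot_iff]
  intro s hs t ht
  obtain ⟨l, hl, hls⟩ := (mem_nhdsGT_iff_exists_Ioo_subset).1 hs
  by_contra hne
  rw [not_nonempty_iff_eq_empty, ← disjoint_iff_inter_eq_empty] at hne
  have h1 : volume (Ioo v l) ≤ volume tᶜ :=
    measure_mono (hls.trans hne.subset_compl_right)
  rw [mem_ae_iff.1 ht, Real.volume_Ioo] at h1
  simp only [nonpos_iff_eq_zero, ENNReal.ofReal_eq_zero] at h1
  linarith [mem_Ioi.1 hl]

/-- `y` has traces, and these are the extreme points of the values at `v` of the set-valued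
map `S`. -/
structure HasTracesIn (y : ℝ → ℝ) (S : ℝ → Set ℝ) : Prop where
  hasTraces : HasTraces y
  left_mem : ∀ v, leftTrace y v ∈ S v
  right_mem : ∀ v, rightTrace y v ∈ S v
  subset : ∀ v, S v ⊆ traceInterval y v

theorem hasTracesIn_of_tendsto {y : ℝ → ℝ} {S : ℝ → Set ℝ}
    (h : ∀ v, ∃ l r, Tendsto y (𝓝[<] v ⊓ ae volume) (𝓝 l) ∧
      Tendsto y (𝓝[>] v ⊓ ae volume) (𝓝 r) ∧ l ∈ S v ∧ r ∈ S v ∧ S v ⊆ uIcc l r) :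
    HasTracesIn y S := by
  have key : ∀ v, leftTrace y v ∈ S v ∧ rightTrace y v ∈ S v ∧ S v ⊆ traceInterval y v := by
    intro v
    obtain ⟨l, r, hl, hr, h1⟩ := h v
    have := neBot_nhdsLT_inf_ae v
    have := neBot_nhdsGT_inf_ae v
    have el : leftTrace y v = l := hl.limUnder_eq
    have er : rightTrace y v = r := hr.limUnder_eq
    rwa [traceInterval, el, er]
  refine ⟨fun v => ?_, fun v => (key v).1, fun v => (key v).2.1, fun v => (key v).2.2⟩
  obtain ⟨l, r, hl, hr, -⟩ := h v
  exact ⟨⟨l, hl⟩, ⟨r, hr⟩⟩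

/-- The graph of `S` contains the limits of its selections. -/
def ClosedSelections (S : ℝ → Set ℝ) : Prop :=
  ∀ (m : ℝ → ℝ) (v c : ℝ) (l : Filter ℝ) [l.NeBot], l ≤ 𝓝 v → (∀ x, m x ∈ S x) →
    Tendsto m l (𝓝 c) → c ∈ S v

/-- A function that selects almost everywhere from a monotone set-valued map agrees almost
everywhere with a monotone selection, hence has traces; these are values of the map if its graph is closed. -/
theorem exists_tendsto_of_monotone_graph {y : ℝ → ℝ} {S : ℝ → Set ℝ}
    (hne : ∀ v, (S v).Nonempty) (hmono : ∀ v v', v < v' → ∀ c ∈ S v, ∀ c' ∈ S v', c ≤ c')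
    (hcl : ClosedSelections S) (hy : ∀ᵐ v, y v ∈ S v) (v : ℝ) :
    ∃ l r, Tendsto y (𝓝[<] v ⊓ ae volume) (𝓝 l) ∧
      Tendsto y (𝓝[>] v ⊓ ae volume) (𝓝 r) ∧ l ∈ S v ∧ r ∈ S v ∧ S v ⊆ Icc l r := by
  classical
  choose s hs using hne
  set m : ℝ → ℝ := fun x => if y x ∈ S x then y x else s x with hm
  have hmS : ∀ x, m x ∈ S x := by
    intro x
    simp only [hm]
    split_ifs with h
    exacts [h, hs x]
  have hmm : Monotone m := by
    intro x x' hxx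
    rcases hxx.eq_or_lt with h | h
    · rw [h]
    · exact hmono x x' h _ (hmS x) _ (hmS x')
  have hmy : ∀ᵐ x, m x = y x := by
    filter_upwards [hy] with x hx using if_pos hx
  have hl := hmm.tendsto_nhdsLT v
  have hr := hmm.tendsto_nhdsGT v
  refine ⟨_, _, (hl.mono_left inf_le_left).congr' (hmy.filter_mono inf_le_right),
    (hr.mono_left inf_le_left).congr' (hmy.filter_mono inf_le_right),
    hcl m v _ _ nhdsWithin_le_nhds hmS hl, hcl m v _ _ nhdsWithin_le_nhds hmS hr,
    fun c hc => ⟨?_, ?_⟩⟩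
  · refine le_of_tendsto hl ?_
    filter_upwards [self_mem_nhdsWithin] with x hx using hmono x v hx _ (hmS x) _ hc
  · refine ge_of_tendsto hr ?_
    filter_upwards [self_mem_nhdsWithin] with x hx using hmono v x hx _ hc _ (hmS x)

theorem maximizers_le_of_lt {f : ℝ → ℝ} {a b v v' c c' : ℝ} (hv : v < v')
    (hc : c ∈ maximizers f a b v) (hc' : c' ∈ maximizers f a b v') : c ≤ c' := by
  have h1 := hc.2 c' hc'.1
  have h2 := hc'.2 c hc.1
  by_contra! h
  nlinarith [mul_pos (sub_pos.2 hv) (sub_pos.2 h)]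

theorem mem_maximizers_of_tendsto {f : ℝ → ℝ} {a b : ℝ} (hf : ContinuousOn f (Icc a b))
    {ι : Type*} {l : Filter ι} [l.NeBot] {m w : ι → ℝ} {v c : ℝ} (hw : Tendsto w l (𝓝 v))
    (hm : Tendsto m l (𝓝 c)) (h : ∀ᶠ i in l, m i ∈ maximizers f a b (w i)) :
    c ∈ maximizers f a b v := by
  have hmI : ∀ᶠ i in l, m i ∈ Icc a b := h.mono fun i hi => hi.1
  have hc : c ∈ Icc a b := isClosed_Icc.mem_of_tendsto hm hmI
  refine ⟨hc, fun c' hc' => ?_⟩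
  have hfm : Tendsto (fun i => f (m i)) l (𝓝 (f c)) :=
    (hf c hc).tendsto.comp (tendsto_nhdsWithin_iff.2 ⟨hm, hmI⟩)
  exact le_of_tendsto_of_tendsto ((hw.const_mul c').sub_const (f c')) ((hm.mul hw).sub hfm)
    (h.mono fun i hi => hi.2 c' hc')

theorem hasTracesIn_maximizers {f : ℝ → ℝ} {a b : ℝ} (hab : a ≤ b)
    (hf : ContinuousOn f (Icc a b)) {y : ℝ → ℝ} (hy : ∀ᵐ v, y v ∈ maximizers f a b v) :
    HasTracesIn y (maximizers f a b) := by
  refine hasTracesIn_of_tendsto fun v => ?_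
  obtain ⟨l, r, h1, h2, h3, h4, h5⟩ := exists_tendsto_of_monotone_graph
    (maximizers_nonempty hab hf) (fun _ _ hv _ hc _ hc' => maximizers_le_of_lt hv hc hc')
    (fun m v c l _ hl hm hlim => mem_maximizers_of_tendsto hf hl hlim (Eventually.of_forall hm))
    hy v
  exact ⟨l, r, h1, h2, h3, h4, h5.trans Icc_subset_uIcc⟩

theorem hasTracesIn_maximizers_neg {f : ℝ → ℝ} {a b : ℝ} (hab : a ≤ b)
    (hf : ContinuousOn f (Icc a b)) {y : ℝ → ℝ} (hy : ∀ᵐ v, y v ∈ maximizers f a b (-v)) :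
    HasTracesIn y fun v => maximizers f a b (-v) := by
  refine hasTracesIn_of_tendsto fun v => ?_
  have hne : ∀ v, {c | -c ∈ maximizers f a b (-v)}.Nonempty := fun v => by
    obtain ⟨c, hc⟩ := maximizers_nonempty hab hf (-v)
    exact ⟨-c, by simpa using hc⟩
  have hcl : ClosedSelections fun v => {c | -c ∈ maximizers f a b (-v)} :=
    fun m v c l _ hl hm hlim => mem_maximizers_of_tendsto hf
      ((continuous_neg.tendsto v).mono_left hl) hlim.neg (Eventually.of_forall hm)
  obtain ⟨l, r, h1, h2, h3, h4, h5⟩ := exists_tendsto_of_monotone_graph (y := fun v => -y v) hne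
    (fun v v' hv c hc c' hc' =>
      neg_le_neg_iff.1 (maximizers_le_of_lt (neg_lt_neg hv) hc' hc)) hcl (by simpa using hy) v
  refine ⟨-l, -r, by simpa using h1.neg, by simpa using h2.neg, h3, h4, fun c hc => ?_⟩
  have := h5 (show -c ∈ {c | -c ∈ maximizers f a b (-v)} by simpa using hc)
  exact Icc_subset_uIcc' ⟨by linarith [this.2], by linarith [this.1]⟩

/-! ### The flux of the `n`-lane model -/

/-- The flux `r ↦ Gⁿ(n r) / n` of the normalized density. -/
noncomputable def scaledFlux (F : ℝ → ℝ) (n : ℕ) (r : ℝ) : ℝ := laneFlux F n (n * r) / n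

theorem lipschitzOnWith_laneFlux (F : ℝ → ℝ) (n : ℕ) :
    ∃ K, LipschitzOnWith K (laneFlux F n) (Icc 0 (n : ℝ)) := by
  refine ⟨∑ i : Fin n, ‖laneRate F n i‖₊, LipschitzOnWith.of_dist_le_mul fun x hx y hy => ?_⟩
  unfold laneFlux macroFlux
  simp only [laneDensity_eq hx, laneDensity_eq hy]
  rw [Real.dist_eq, ← Finset.sum_sub_distrib, NNReal.coe_sum, Finset.sum_mul]
  refine (Finset.abs_sum_le_sum_abs _ _).trans (Finset.sum_le_sum fun i _ => ?_)
  rw [← mul_sub, abs_mul, coe_nnnorm, Real.norm_eq_abs, Real.dist_eq]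
  refine mul_le_mul_of_nonneg_left ?_ (abs_nonneg _)
  set p : ℝ → ℝ := fun x => max 0 (min 1 (x - (i : ℕ))) with hp
  have hp0 : ∀ x, 0 ≤ p x := fun x => le_max_left _ _
  have hp1 : ∀ x, p x ≤ 1 := fun x => max_le zero_le_one (min_le_left _ _)
  have hpd : |p x - p y| ≤ |x - y| := by
    refine (abs_max_sub_max_le_max _ _ _ _).trans (max_le (by simp) ?_)
    refine (abs_min_sub_min_le_max _ _ _ _).trans (max_le (by simp) ?_)
    simp
  have e : p x * (1 - p x) - p y * (1 - p y) = (p x - p y) * (1 - p x - p y) := by ring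
  change |p x * (1 - p x) - p y * (1 - p y)| ≤ |x - y|
  rw [e, abs_mul]
  refine (mul_le_of_le_one_right (abs_nonneg _) (abs_le.2 ⟨?_, ?_⟩)).trans hpd
  · linarith [hp1 x, hp1 y]
  · linarith [hp0 x, hp0 y]

theorem scaledFlux_eq (F : ℝ → ℝ) {n i : ℕ} (hi : i < n) {r : ℝ} (h1 : (i : ℝ) ≤ n * r)
    (h2 : n * r ≤ i + 1) :
    scaledFlux F n r = F (i / n) * (4 * ((n * r - i) * (i + 1 - n * r))) := by
  have hn : (0 : ℝ) < n := by exact_mod_cast (Nat.zero_le i).trans_lt hi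
  have hin : (i : ℝ) + 1 ≤ n := by exact_mod_cast hi
  have h0 : (0 : ℝ) ≤ i := Nat.cast_nonneg i
  have hρ : n * r ∈ Icc (0 : ℝ) n := ⟨h0.trans h1, h2.trans hin⟩
  rw [scaledFlux, laneFlux_eq F hρ, Finset.sum_eq_single ⟨i, hi⟩]
  · have e : (Ioo ((i : ℕ) : ℝ) ((i : ℕ) + 1)).indicator
        (fun s => (s - (i : ℕ)) * ((i : ℕ) + 1 - s)) (n * r) = (n * r - i) * (i + 1 - n * r) := by
      by_cases h : n * r ∈ Ioo (i : ℝ) (i + 1)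
      · rw [indicator_of_mem h]
      · rw [indicator_of_notMem h]
        rcases h1.eq_or_lt with h3 | h3
        · rw [← h3]; ring
        · rcases h2.eq_or_lt with h4 | h4
          · rw [h4]; ring
          · exact absurd ⟨h3, h4⟩ h
    simp only [e, laneRate]
    field_simp
  · intro j _ hj
    rw [indicator_of_notMem, mul_zero]
    rintro ⟨h3, h4⟩
    have h5 : (j : ℕ) < i + 1 := by exact_mod_cast h3.trans_le h2
    have h6 : i < (j : ℕ) + 1 := by exact_mod_cast h1.trans_lt h4
    exact hj (Fin.ext (by simp; omega))
  · simp

theorem exists_lane {n : ℕ} (hn : 1 ≤ n) {r : ℝ} (hr : r ∈ Icc (0 : ℝ) 1) :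
    ∃ i < n, (i : ℝ) ≤ n * r ∧ n * r ≤ i + 1 := by
  have hn' : (1 : ℝ) ≤ n := by exact_mod_cast hn
  rcases hr.2.eq_or_lt with h | h
  · refine ⟨n - 1, by omega, ?_, ?_⟩ <;> rw [Nat.cast_sub hn, h] <;> simp
  · have h0 : 0 ≤ n * r := mul_nonneg (by linarith) hr.1
    refine ⟨⌊n * r⌋₊, ?_, Nat.floor_le h0, (Nat.lt_floor_add_one _).le⟩
    rw [Nat.floor_lt h0]
    nlinarith

theorem lane_mem {n i : ℕ} (hi : i ≤ n) : (i : ℝ) / n ∈ Icc (0 : ℝ) 1 :=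
  ⟨by positivity, div_le_one_of_le₀ (by exact_mod_cast hi) (by positivity)⟩

theorem scaledFlux_nonneg {F : ℝ → ℝ} (hF : ∀ x ∈ Icc (0 : ℝ) 1, 0 ≤ F x) {n : ℕ} (hn : 1 ≤ n)
    {r : ℝ} (hr : r ∈ Icc (0 : ℝ) 1) : 0 ≤ scaledFlux F n r := by
  obtain ⟨i, hi, h1, h2⟩ := exists_lane hn hr
  rw [scaledFlux_eq F hi h1 h2]
  exact mul_nonneg (hF _ (lane_mem hi.le))
    (mul_nonneg (by norm_num) (mul_nonneg (by linarith) (by linarith)))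

theorem scaledFlux_lane (F : ℝ → ℝ) {n i : ℕ} (hn : 1 ≤ n) (hi : i ≤ n) :
    scaledFlux F n (i / n) = 0 := by
  have hn' : (n : ℝ) ≠ 0 := by positivity
  have e : (n : ℝ) * (i / n) = i := mul_div_cancel₀ _ hn'
  obtain ⟨j, hj, h1, h2⟩ := exists_lane hn (lane_mem hi)
  rw [scaledFlux_eq F hj h1 h2]
  rw [e] at h1 h2 ⊢
  have h3 : j ≤ i := by exact_mod_cast h1
  have h4 : i ≤ j + 1 := by exact_mod_cast h2
  rcases (by omega : i = j ∨ i = j + 1) with h | h <;> rw [h] <;> push_cast <;> ring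

theorem scaledFlux_le {F : ℝ → ℝ} {K : NNReal} (hK : LipschitzOnWith K F (Icc 0 1))
    (hF : ∀ x ∈ Icc (0 : ℝ) 1, 0 ≤ F x) {n : ℕ} (hn : 1 ≤ n) {r : ℝ} (hr : r ∈ Icc (0 : ℝ) 1) :
    scaledFlux F n r ≤ F r + K / n := by
  have hn' : (0 : ℝ) < n := by exact_mod_cast hn
  obtain ⟨i, hi, h1, h2⟩ := exists_lane hn hr
  have h3 := hK.dist_le_mul _ (lane_mem hi.le) _ hr
  rw [Real.dist_eq, Real.dist_eq] at h3
  have h4 : |(i : ℝ) / n - r| ≤ 1 / n := by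
    have e : (i : ℝ) / n - r = (i - n * r) / n := by field_simp
    rw [e, abs_div, abs_of_pos hn']
    gcongr
    exact abs_le.2 ⟨by linarith, by linarith⟩
  have h5 := (le_abs_self _).trans (h3.trans (mul_le_mul_of_nonneg_left h4 K.2))
  rw [mul_one_div] at h5
  rw [scaledFlux_eq F hi h1 h2]
  -- `4 s (1 - s) ≤ 1`
  have h6 : 4 * ((n * r - i) * (i + 1 - n * r)) ≤ 1 := by
    nlinarith [sq_nonneg (2 * (n * r - i) - 1)]
  have h7 := mul_le_of_le_one_right (hF _ (lane_mem hi.le)) h6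
  linarith

/-- The top of a hill lies within `1 / n` of any point of an interval of length at least `1 / n`. -/
theorem exists_le_scaledFlux {F : ℝ → ℝ} {K : NNReal} (hK : LipschitzOnWith K F (Icc 0 1))
    {a b : ℝ} (ha : 0 ≤ a) (hb : b ≤ 1) {n : ℕ} (hn : 1 ≤ n) (hab : 1 / (n : ℝ) ≤ b - a) {c : ℝ}
    (hc : c ∈ Icc a b) :
    ∃ c' ∈ Icc a b, |c' - c| ≤ 1 / n ∧ F c - 2 * K / n ≤ scaledFlux F n c' := by
  have hn' : (0 : ℝ) < n := by exact_mod_cast hn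
  have hn1 : 0 < 1 / (n : ℝ) := by positivity
  -- move `c` into the interval shrunk by half a lane
  set d : ℝ := max (a + 1 / n / 2) (min (b - 1 / n / 2) c) with hd
  have hd1 : a + 1 / n / 2 ≤ d := le_max_left _ _
  have hd2 : d ≤ b - 1 / n / 2 := max_le (by linarith) (min_le_left _ _)
  have hd3 : |d - c| ≤ 1 / n / 2 := by
    refine abs_le.2 ⟨?_, ?_⟩
    · have : c - 1 / n / 2 ≤ min (b - 1 / n / 2) c := le_min (by linarith [hc.2]) (by linarith)
      linarith [le_max_right (a + 1 / (n : ℝ) / 2) (min (b - 1 / n / 2) c)]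
    · have : d ≤ c + 1 / n / 2 :=
        max_le (by linarith [hc.1]) ((min_le_right _ _).trans (by linarith))
      linarith
  have h0 : 0 ≤ n * d := mul_nonneg hn'.le (by linarith)
  have h1 := Nat.floor_le h0
  have h2 := Nat.lt_floor_add_one (n * d)
  set i := ⌊n * d⌋₊
  have g1 : (i : ℝ) / n ≤ d := by rw [div_le_iff₀ hn']; linarith
  have g2 : d < i / n + 1 / n := by rw [← add_div, lt_div_iff₀ hn']; linarith
  have hi : i < n := by
    have : (i : ℝ) < n := by
      rw [← div_lt_one hn']
      linarith
    exact_mod_cast this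
  refine ⟨i / n + 1 / n / 2, ⟨by linarith, by linarith⟩, ?_, ?_⟩
  · have h3 := abs_le.1 hd3
    exact abs_le.2 ⟨by linarith, by linarith⟩
  · have e : (n : ℝ) * (i / n + 1 / n / 2) = i + 1 / 2 := by field_simp
    rw [scaledFlux_eq F hi (by rw [e]; linarith) (by rw [e]; linarith), e]
    have h3 := hK.dist_le_mul _ (⟨ha.trans hc.1, hc.2.trans hb⟩ : c ∈ Icc (0 : ℝ) 1) _
      (lane_mem hi.le)
    rw [Real.dist_eq, Real.dist_eq] at h3
    have h4 : |c - i / n| ≤ 2 / n := by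
      have h3 := abs_le.1 hd3
      have e2 : 2 / (n : ℝ) = 2 * (1 / n) := by ring
      rw [e2]
      exact abs_le.2 ⟨by linarith, by linarith⟩
    have h5 := (le_abs_self _).trans (h3.trans (mul_le_mul_of_nonneg_left h4 K.2))
    have e3 : (K : ℝ) * (2 / n) = 2 * K / n := by ring
    rw [e3] at h5
    ring_nf at h5 ⊢
    linarith

theorem div_mem_maximizers {f : ℝ → ℝ} {a b v c N : ℝ} (hN : 0 < N)
    (hc : c ∈ maximizers f (N * a) (N * b) v) :
    c / N ∈ maximizers (fun r => f (N * r) / N) a b v := by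
  refine ⟨⟨?_, ?_⟩, fun c' hc' => ?_⟩
  · rw [le_div_iff₀ hN, mul_comm]; exact hc.1.1
  · rw [div_le_iff₀ hN, mul_comm]; exact hc.1.2
  · have h1 := hc.2 (N * c')
      ⟨mul_le_mul_of_nonneg_left hc'.1 hN.le, mul_le_mul_of_nonneg_left hc'.2 hN.le⟩
    have e1 : c' * v - f (N * c') / N = (N * c' * v - f (N * c')) / N := by field_simp
    have e2 : c / N * v - f (N * (c / N)) / N = (c * v - f c) / N := by
      rw [mul_div_cancel₀ c hN.ne']
      field_simp
    simp only [e1, e2]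
    gcongr

theorem continuousOn_scaledFlux (F : ℝ → ℝ) {n : ℕ} {s : Set ℝ} (hs : s ⊆ Icc 0 1) :
    ContinuousOn (scaledFlux F n) s := by
  obtain ⟨K, hK⟩ := lipschitzOnWith_laneFlux F n
  refine (hK.continuousOn.comp (by fun_prop) fun r hr => ?_).div_const _
  have := hs hr
  exact ⟨mul_nonneg (Nat.cast_nonneg _) this.1, mul_le_of_le_one_right (Nat.cast_nonneg _) this.2⟩

/-- Increasing data: `ûⁿ(·,1)` has its traces among the maximizers of `c v - Gⁿ(n c) / n`. -/
theorem hasTracesIn_scaled {F : ℝ → ℝ} {α β : ℝ} {n : ℕ} {u : ℝ → ℝ → ℝ} (hn : 1 ≤ n)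
    (hα : α ∈ Icc (0 : ℝ) 1) (hβ : β ∈ Icc (0 : ℝ) 1) (hαβ : α ≤ β)
    (hu : IsEntropySolution n (laneFlux F n) (fun x => n * riemann α β x) u) :
    HasTracesIn (fun x => u 1 x / n) (maximizers (scaledFlux F n) α β) := by
  have hn' : (0 : ℝ) < n := by exact_mod_cast hn
  have e : (fun x => n * riemann α β x) = riemann (n * α) (n * β) := by
    funext x
    unfold riemann
    split_ifs <;> rfl
  rw [e] at hu
  obtain ⟨K, hK⟩ := lipschitzOnWith_laneFlux F n
  have hmem : ∀ c ∈ Icc (0 : ℝ) 1, n * c ∈ Icc (0 : ℝ) n := fun c hc =>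
    ⟨mul_nonneg hn'.le hc.1, mul_le_of_le_one_right hn'.le hc.2⟩
  refine hasTracesIn_maximizers hαβ (continuousOn_scaledFlux F (Icc_subset_Icc hα.1 hβ.2)) ?_
  filter_upwards [hu.ae_mem_maximizers hK (hmem _ hα) (hmem _ hβ)
    (mul_le_mul_of_nonneg_left hαβ hn'.le)] with x hx
  exact div_mem_maximizers hn' hx

/-- Decreasing data: `ûⁿ(·,1)` has its traces among the maximizers of `Gⁿ(n c) / n - c v`. -/
theorem hasTracesIn_scaled_neg {F : ℝ → ℝ} {α β : ℝ} {n : ℕ} {u : ℝ → ℝ → ℝ} (hn : 1 ≤ n)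
    (hα : α ∈ Icc (0 : ℝ) 1) (hβ : β ∈ Icc (0 : ℝ) 1) (hβα : β ≤ α)
    (hu : IsEntropySolution n (laneFlux F n) (fun x => n * riemann α β x) u) :
    HasTracesIn (fun x => u 1 x / n) fun v => maximizers (-scaledFlux F n) β α (-v) := by
  have hn' : (0 : ℝ) < n := by exact_mod_cast hn
  have e : (fun x => n * riemann α β x) = riemann (n * α) (n * β) := by
    funext x
    unfold riemann
    split_ifs <;> rfl
  rw [e] at hu
  obtain ⟨K, hK⟩ := lipschitzOnWith_laneFlux F n
  have hmem : ∀ c ∈ Icc (0 : ℝ) 1, n * c ∈ Icc (0 : ℝ) n := fun c hc =>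
    ⟨mul_nonneg hn'.le hc.1, mul_le_of_le_one_right hn'.le hc.2⟩
  refine hasTracesIn_maximizers_neg hβα
    (continuousOn_scaledFlux F (Icc_subset_Icc hβ.1 hα.2)).neg ?_
  filter_upwards [hu.ae_mem_maximizers_neg hK (hmem _ hα) (hmem _ hβ)
    (mul_le_mul_of_nonneg_left hβα hn'.le)] with x hx
  have e2 : -scaledFlux F n = fun r => (-laneFlux F n) (n * r) / n := by
    funext r
    simp [scaledFlux, neg_div]
  rw [e2]
  exact div_mem_maximizers hn' hx

/-! ### Stability of maximizers -/

/-- If `h` is nearly above `g`, and nearly below `g` at some point close to any given one, then its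
maximizers are close to those of `g`, uniformly for nearby slopes. -/
theorem infDist_maximizers_lt {g : ℝ → ℝ} {a b : ℝ} (ha : 0 ≤ a) (hb : b ≤ 1) (hab : a ≤ b)
    (hg : ContinuousOn g (Icc a b)) {v : ℝ} {I : Set ℝ} (hI : maximizers g a b v ⊆ I) {ε : ℝ}
    (hε : 0 < ε) :
    ∃ κ > 0, ∀ (x : ℝ) (h : ℝ → ℝ), |x - v| ≤ κ → (∀ c ∈ Icc a b, g c - κ ≤ h c) →
      (∀ c ∈ Icc a b, ∃ c' ∈ Icc a b, |c' - c| ≤ κ ∧ h c' ≤ g c + κ) →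
      ∀ c ∈ maximizers h a b x, Metric.infDist c I < ε := by
  have hKc : IsCompact (Icc a b ∩ {c | ε ≤ Metric.infDist c I}) :=
    isCompact_Icc.inter_right (isClosed_le continuous_const (Metric.continuous_infDist_pt I))
  rcases (Icc a b ∩ {c | ε ≤ Metric.infDist c I}).eq_empty_or_nonempty with hK | hK
  · refine ⟨1, one_pos, fun x h _ _ _ c hc => ?_⟩
    by_contra! hlt
    exact (hK ▸ (⟨hc.1, hlt⟩ : c ∈ Icc a b ∩ {c | ε ≤ Metric.infDist c I}) : c ∈ (∅ : Set ℝ))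
  obtain ⟨c₁, hc₁, hmax⟩ := hKc.exists_isMaxOn hK (f := fun c => c * v - g c)
    ((continuousOn_id.mul continuousOn_const).sub (hg.mono inter_subset_left))
  obtain ⟨c₀, hc₀⟩ := maximizers_nonempty hab hg v
  -- away from `I` the maximum is missed by a fixed amount
  have hη : c₁ * v - g c₁ < c₀ * v - g c₀ := by
    by_contra! hle
    have : c₁ ∈ maximizers g a b v := ⟨hc₁.1, fun c' hc' => (hc₀.2 c' hc').trans hle⟩
    have h0 : Metric.infDist c₁ I = 0 := Metric.infDist_zero_of_mem (hI this)
    have h1 : ε ≤ Metric.infDist c₁ I := hc₁.2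
    linarith
  set η := (c₀ * v - g c₀) - (c₁ * v - g c₁) with hηdef
  have hη0 : 0 < η := by linarith
  have hv : 0 < |v| + 6 := by positivity
  refine ⟨min 1 (η / (|v| + 6)), lt_min one_pos (div_pos hη0 hv), ?_⟩
  set κ := min 1 (η / (|v| + 6)) with hκdef
  have hκ0 : 0 < κ := lt_min one_pos (div_pos hη0 hv)
  have hκ1 : κ ≤ 1 := min_le_left _ _
  have hκη : κ * (|v| + 6) ≤ η := (le_div_iff₀ hv).1 (min_le_right _ _)
  intro x h hx h1 h2 c hc
  by_contra! hlt
  have hmc : c * v - g c ≤ c₁ * v - g c₁ := hmax ⟨hc.1, hlt⟩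
  obtain ⟨c', hc', hcc, hhc⟩ := h2 c₀ hc₀.1
  have e1 := hc.2 c' hc'
  have e2 := h1 c hc.1
  have hslope : ∀ d ∈ Icc a b, |d * x - d * v| ≤ κ := by
    intro d hd
    rw [← mul_sub, abs_mul, abs_of_nonneg (ha.trans hd.1)]
    exact (mul_le_of_le_one_left (abs_nonneg _) (hd.2.trans hb)).trans hx
  have hxv : |x| ≤ |v| + 1 := by
    have := abs_sub_abs_le_abs_sub x v
    linarith
  have hpt : |c' * x - c₀ * x| ≤ κ * (|v| + 1) := by
    rw [← sub_mul, abs_mul]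
    exact mul_le_mul hcc hxv (abs_nonneg _) hκ0.le
  have f1 := (abs_le.1 (hslope c hc.1)).2
  have f2 := (abs_le.1 (hslope c₀ hc₀.1)).1
  have f3 := (abs_le.1 hpt).1
  nlinarith

/-! ### Increasing data -/

/-- To the right of `0` the maximizers lie between the last zero of the flux before `β` and `β`
itself, whatever the slope `x > 0`; this is what makes the convergence uniform up to `0`. -/
theorem abs_sub_le_of_mem_maximizers_of_pos {F : ℝ → ℝ} (hF : ∀ x ∈ Icc (0 : ℝ) 1, 0 ≤ F x)
    {α β : ℝ} (hα : α ∈ Icc (0 : ℝ) 1) (hβ : β ∈ Icc (0 : ℝ) 1) {n : ℕ} (hn : 1 ≤ n) {x c : ℝ}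
    (hx : 0 < x) (hc : c ∈ maximizers (scaledFlux F n) α β x) : |c - β| ≤ 1 / n := by
  have hn' : (0 : ℝ) < n := by exact_mod_cast hn
  have h0 : 0 ≤ n * β := mul_nonneg hn'.le hβ.1
  have h1 : (⌊n * β⌋₊ : ℝ) / n ≤ β := by
    rw [div_le_iff₀ hn', mul_comm β]
    exact Nat.floor_le h0
  have h2 : β < (⌊n * β⌋₊ : ℝ) / n + 1 / n := by
    rw [← add_div, lt_div_iff₀ hn', mul_comm β]
    exact Nat.lt_floor_add_one _
  -- the last zero of the flux before `β` is a better choice than any point to its left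
  have h3 : (⌊n * β⌋₊ : ℝ) / n ≤ c := by
    rcases lt_or_ge ((⌊n * β⌋₊ : ℝ) / n) α with h | h
    · exact h.le.trans hc.1.1
    · have h4 := hc.2 _ ⟨h, h1⟩
      rw [scaledFlux_lane F hn (Nat.floor_le_of_le
        (mul_le_of_le_one_right hn'.le hβ.2))] at h4
      have h5 := scaledFlux_nonneg hF hn
        (⟨hα.1.trans hc.1.1, hc.1.2.trans hβ.2⟩ : c ∈ Icc (0 : ℝ) 1)
      exact le_of_mul_le_mul_right (by linarith) hx
  exact abs_le.2 ⟨by linarith, by linarith [hc.1.2, one_div_pos.2 hn']⟩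

theorem abs_sub_le_of_mem_maximizers_of_neg {F : ℝ → ℝ} (hF : ∀ x ∈ Icc (0 : ℝ) 1, 0 ≤ F x)
    {α β : ℝ} (hα : α ∈ Icc (0 : ℝ) 1) (hβ : β ∈ Icc (0 : ℝ) 1) {n : ℕ} (hn : 1 ≤ n) {x c : ℝ}
    (hx : x < 0) (hc : c ∈ maximizers (scaledFlux F n) α β x) : |c - α| ≤ 1 / n := by
  have hn' : (0 : ℝ) < n := by exact_mod_cast hn
  have h0 : 0 ≤ n * α := mul_nonneg hn'.le hα.1
  have h1 : α ≤ (⌈n * α⌉₊ : ℝ) / n := by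
    rw [le_div_iff₀ hn', mul_comm α]
    exact Nat.le_ceil _
  have h2 : (⌈n * α⌉₊ : ℝ) / n < α + 1 / n := by
    rw [div_lt_iff₀ hn', add_mul, one_div_mul_cancel hn'.ne', mul_comm α]
    exact Nat.ceil_lt_add_one h0
  have h3 : c ≤ (⌈n * α⌉₊ : ℝ) / n := by
    rcases lt_or_ge β ((⌈n * α⌉₊ : ℝ) / n) with h | h
    · exact hc.1.2.trans h.le
    · have h4 := hc.2 _ ⟨h1, h⟩
      rw [scaledFlux_lane F hn (Nat.ceil_le.2
        (mul_le_of_le_one_right hn'.le hα.2))] at h4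
      have h5 := scaledFlux_nonneg hF hn
        (⟨hα.1.trans hc.1.1, hc.1.2.trans hβ.2⟩ : c ∈ Icc (0 : ℝ) 1)
      exact (mul_le_mul_right_of_neg hx).1 (by linarith)
  exact abs_le.2 ⟨by linarith [hc.1.1, one_div_pos.2 hn'], by linarith⟩

/-- The Riemann datum itself is the solution at time `1` for the zero flux. -/
theorem hasTracesIn_riemann {α β : ℝ} (hαβ : α ≤ β) :
    HasTracesIn (riemann α β) (maximizers 0 α β) := by
  refine hasTracesIn_maximizers hαβ continuousOn_const ?_
  have h0 : ∀ᵐ x : ℝ, x ≠ 0 := by simp [ae_iff, measure_singleton]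
  filter_upwards [h0] with x hx
  refine ⟨riemann_mem (left_mem_Icc.2 hαβ) (right_mem_Icc.2 hαβ) x, fun c hc => ?_⟩
  change c * x - 0 ≤ riemann α β x * x - 0
  rw [sub_zero, sub_zero, riemann]
  split_ifs with h
  · exact mul_le_mul_of_nonpos_right hc.1 h
  · exact mul_le_mul_of_nonneg_right hc.2 (by linarith)

/-- Increasing data: the distance to the limit is at most one lane, on each half-line and at
its end. -/
theorem infDist_traceInterval_riemann_le {F : ℝ → ℝ} (hF : ∀ x ∈ Icc (0 : ℝ) 1, 0 ≤ F x)
    {α β : ℝ} (hα : α ∈ Icc (0 : ℝ) 1) (hβ : β ∈ Icc (0 : ℝ) 1) (hαβ : α ≤ β) {n : ℕ} (hn : 1 ≤ n)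
    {y : ℝ → ℝ} (hy : HasTracesIn y (maximizers (scaledFlux F n) α β)) {v x w : ℝ}
    (hvx : v = 0 ∨ (0 < v ∧ 0 < x) ∨ (v < 0 ∧ x < 0)) (hw : w ∈ traceInterval y x) :
    Metric.infDist w (traceInterval (riemann α β) v) ≤ 1 / n := by
  have hr := hasTracesIn_riemann hαβ
  have hn' : (0 : ℝ) < n := by exact_mod_cast hn
  have hlm := hy.left_mem x
  have hrm := hy.right_mem x
  have hsub : ∀ s : Set ℝ, OrdConnected s → leftTrace y x ∈ s → rightTrace y x ∈ s → w ∈ s :=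
    fun s hs h1 h2 => hs.uIcc_subset h1 h2 hw
  have hmem : leftTrace (riemann α β) v ∈ traceInterval (riemann α β) v := left_mem_uIcc
  have hlv := hr.left_mem v
  rcases hvx with rfl | ⟨hv, hx⟩ | ⟨hv, hx⟩
  · have h1 : w ∈ Icc α β := hsub _ ordConnected_Icc hlm.1 hrm.1
    have h2 : w ∈ maximizers 0 α β 0 := ⟨h1, by simp⟩
    rw [Metric.infDist_zero_of_mem (hr.subset 0 h2)]
    positivity
  · have e : leftTrace (riemann α β) v = β := by
      have := hlv.2 β (right_mem_Icc.2 hαβ)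
      simp only [Pi.zero_apply, sub_zero] at this
      exact le_antisymm hlv.1.2 (le_of_mul_le_mul_right this hv)
    rw [e] at hmem
    refine (Metric.infDist_le_dist_of_mem hmem).trans ?_
    have hball : ∀ c, c ∈ Metric.closedBall β (1 / n) ↔ |c - β| ≤ 1 / n := fun c => by
      rw [Metric.mem_closedBall, Real.dist_eq]
    refine hsub (Metric.closedBall β (1 / n)) (convex_closedBall _ _).ordConnected ?_ ?_
    · exact (hball _).2 (abs_sub_le_of_mem_maximizers_of_pos hF hα hβ hn hx hlm)
    · exact (hball _).2 (abs_sub_le_of_mem_maximizers_of_pos hF hα hβ hn hx hrm)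
  · have e : leftTrace (riemann α β) v = α := by
      have := hlv.2 α (left_mem_Icc.2 hαβ)
      simp only [Pi.zero_apply, sub_zero] at this
      exact le_antisymm ((mul_le_mul_right_of_neg hv).1 this) hlv.1.1
    rw [e] at hmem
    refine (Metric.infDist_le_dist_of_mem hmem).trans ?_
    have hball : ∀ c, c ∈ Metric.closedBall α (1 / n) ↔ |c - α| ≤ 1 / n := fun c => by
      rw [Metric.mem_closedBall, Real.dist_eq]
    refine hsub (Metric.closedBall α (1 / n)) (convex_closedBall _ _).ordConnected ?_ ?_
    · exact (hball _).2 (abs_sub_le_of_mem_maximizers_of_neg hF hα hβ hn hx hlm)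
    · exact (hball _).2 (abs_sub_le_of_mem_maximizers_of_neg hF hα hβ hn hx hrm)

/-! ### Decreasing data -/

/-- The normalized flux oscillates between `0` and, up to `O(1 / n)`, the envelope `F`; only the
envelope matters for the maximizers of `Gⁿ(n c) / n - c x`. -/
theorem exists_infDist_maximizers_scaledFlux_lt {F : ℝ → ℝ} {K : NNReal}
    (hK : LipschitzOnWith K F (Icc 0 1)) (hF : ∀ x ∈ Icc (0 : ℝ) 1, 0 ≤ F x) {a b : ℝ}
    (ha : 0 ≤ a) (hb : b ≤ 1) (hab : a < b) {v : ℝ} {I : Set ℝ}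
    (hI : maximizers (-F) a b (-v) ⊆ I) {ε : ℝ} (hε : 0 < ε) :
    ∃ δ > 0, ∃ n₀, ∀ x, |x - v| < δ →
      (∀ n ≥ n₀, 1 ≤ n → ∀ c ∈ maximizers (-scaledFlux F n) a b (-x), Metric.infDist c I < ε) ∧
      ∀ c ∈ maximizers (-F) a b (-x), Metric.infDist c I < ε := by
  have hsub : Icc a b ⊆ Icc (0 : ℝ) 1 := Icc_subset_Icc ha hb
  have hFc : ContinuousOn (-F) (Icc a b) := (hK.continuousOn.mono hsub).neg
  obtain ⟨κ, hκ, h⟩ := infDist_maximizers_lt ha hb hab.le hFc hI hε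
  obtain ⟨n₀, hn₀⟩ := exists_nat_gt (max ((2 * K + 1) / κ) (1 / (b - a)))
  refine ⟨κ, hκ, n₀, fun x hx => ?_⟩
  have hx' : |-x - -v| ≤ κ := by
    rw [neg_sub_neg, abs_sub_comm]
    exact hx.le
  refine ⟨fun n hn hn1 c hc => ?_, fun c hc => ?_⟩
  · have hn' : (0 : ℝ) < n := by exact_mod_cast hn1
    have hnn : max ((2 * K + 1) / κ) (1 / (b - a)) < n := hn₀.trans_le (by exact_mod_cast hn)
    have h1 : (2 * K + 1) / n < κ := by
      have := (le_max_left _ _).trans_lt hnn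
      rw [div_lt_iff₀ hκ] at this
      rw [div_lt_iff₀ hn']
      linarith
    have h2 : 1 / (n : ℝ) ≤ b - a := by
      have := (le_max_right _ _).trans_lt hnn
      rw [div_lt_iff₀ (by linarith)] at this
      rw [div_le_iff₀ hn']
      linarith
    rw [add_div] at h1
    have h3 : 0 ≤ 2 * (K : ℝ) / n := by positivity
    have h4 : (K : ℝ) / n ≤ 2 * K / n := by
      have := K.2
      gcongr
      linarith [K.2]
    have h5 : 0 < 1 / (n : ℝ) := by positivity
    refine h (-x) _ hx' (fun c hc => ?_) (fun c hc => ?_) c hc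
    · have := scaledFlux_le hK hF hn1 (hsub hc)
      simp only [Pi.neg_apply]
      linarith
    · obtain ⟨c', hc', hd, hle⟩ := exists_le_scaledFlux hK ha hb hn1 h2 hc
      refine ⟨c', hc', by linarith, ?_⟩
      simp only [Pi.neg_apply]
      linarith
  · exact h (-x) _ hx' (fun c _ => by linarith)
      (fun c hc => ⟨c, hc, by simpa using hκ.le, by linarith⟩) c hc

theorem infDist_lt_of_mem_traceInterval {y : ℝ → ℝ} {v w ε : ℝ} {a b : ℝ}
    (hl : Metric.infDist (leftTrace y v) (uIcc a b) < ε)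
    (hr : Metric.infDist (rightTrace y v) (uIcc a b) < ε) (hw : w ∈ traceInterval y v) :
    Metric.infDist w (uIcc a b) < ε := by
  rw [← Metric.mem_thickening_iff_infDist_lt nonempty_uIcc] at hl hr ⊢
  exact ((convex_uIcc a b).thickening ε).ordConnected.uIcc_subset hl hr hw

theorem mainTheorem4
    (F : ℝ → ℝ) (hF : ContDiffOn ℝ 1 F (Icc 0 1)) (hFpos : ∀ x ∈ Ioo (0 : ℝ) 1, 0 < F x)
    (hF0 : F 0 = 0) (hF1 : F 1 = 0)
    (α β : ℝ) (hα : α ∈ Icc (0 : ℝ) 1) (hβ : β ∈ Icc (0 : ℝ) 1)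
    -- `u n` is the entropy solution for the (unnormalized) flux `Gⁿ` on `[0,n]`, started from
    -- the datum whose normalization is the Riemann datum
    (u : ℕ → ℝ → ℝ → ℝ)
    (hu : ∀ n : ℕ, 1 ≤ n →
      IsEntropySolution n (laneFlux F n) (fun x => n * riemann α β x) (u n))
    -- the profile `û(·,1)`
    (uhat : ℝ → ℝ)
    (huhat_gt : β < α → ∃ U, IsEntropySolution 1 F (riemann α β) U ∧ uhat = U 1)
    (huhat_le : α ≤ β → uhat = riemann α β) :
    -- the one-sided limits `û(v±,1)` and `ûⁿ(v±,1)` exist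
    HasTraces uhat ∧ (∀ n : ℕ, 1 ≤ n → HasTraces (fun x => u n 1 x / n)) ∧
    -- for each choice `w n v` of the value `ûⁿ(v,1)` between `ûⁿ(v-,1)` and `ûⁿ(v+,1)`
    ∀ w : ℕ → ℝ → ℝ,
      (∀ n : ℕ, 1 ≤ n → ∀ v, w n v ∈ traceInterval (fun x => u n 1 x / n) v) →
      (∀ v, Tendsto (fun p : ℕ × ℝ => Metric.infDist (w p.1 p.2) (traceInterval uhat v))
        (atTop ×ˢ 𝓝 v) (𝓝 0)) ∧
      TendstoLocallyUniformlyOn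
        (fun (n : ℕ) (v : ℝ) => Metric.infDist (w n v) (traceInterval uhat v)) (fun _ => 0) atTop
        {v | α ≤ β ∨ leftTrace uhat v = rightTrace uhat v} ∧
      ∀ v, leftTrace uhat v = rightTrace uhat v →
        Tendsto (fun n => w n v) atTop (𝓝 (leftTrace uhat v)) := by
  have hFnn : ∀ x ∈ Icc (0 : ℝ) 1, 0 ≤ F x := by
    intro x hx
    rcases hx.1.eq_or_lt with h | h
    · rw [← h, hF0]
    · rcases hx.2.eq_or_lt with h' | h'
      · rw [h', hF1]
      · exact (hFpos x ⟨h, h'⟩).le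
  obtain ⟨K, hK⟩ := hF.exists_lipschitzOnWith one_ne_zero (convex_Icc 0 1) isCompact_Icc
  -- the limits in `ε`-`δ` form; the pointwise limit is a case of the joint limit
  suffices H : HasTraces uhat ∧ (∀ n : ℕ, 1 ≤ n → HasTraces (fun x => u n 1 x / n)) ∧
      ∀ w : ℕ → ℝ → ℝ,
        (∀ n : ℕ, 1 ≤ n → ∀ v, w n v ∈ traceInterval (fun x => u n 1 x / n) v) →
        (∀ v, ∀ ε > 0, ∃ δ > 0, ∃ n₀, ∀ n ≥ n₀, ∀ x, |x - v| < δ →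
          Metric.infDist (w n x) (traceInterval uhat v) < ε) ∧
        ∀ v, (α ≤ β ∨ leftTrace uhat v = rightTrace uhat v) → ∀ ε > 0, ∃ δ > 0, ∃ n₀, ∀ n ≥ n₀,
          ∀ x, |x - v| < δ → Metric.infDist (w n x) (traceInterval uhat x) < ε by
    refine ⟨H.1, H.2.1, fun w hw => ?_⟩
    obtain ⟨h1, h2⟩ := H.2.2 w hw
    refine ⟨fun v => ?_, ?_, fun v hv => ?_⟩
    · rw [Metric.tendsto_nhds]
      intro ε hε
      obtain ⟨δ, hδ, n₀, h⟩ := h1 v ε hε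
      have hb : ∀ᶠ x in 𝓝 v, |x - v| < δ := Metric.ball_mem_nhds v hδ
      filter_upwards [(eventually_ge_atTop n₀).prod_mk hb] with p hp
      rw [Real.dist_eq, sub_zero, abs_of_nonneg Metric.infDist_nonneg]
      exact h p.1 hp.1 p.2 hp.2
    · rw [Metric.tendstoLocallyUniformlyOn_iff]
      intro ε hε v hv
      obtain ⟨δ, hδ, n₀, h⟩ := h2 v hv ε hε
      refine ⟨Metric.ball v δ, mem_nhdsWithin_of_mem_nhds (Metric.ball_mem_nhds v hδ), ?_⟩
      filter_upwards [eventually_ge_atTop n₀] with n hn x hx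
      rw [dist_comm, Real.dist_eq, sub_zero, abs_of_nonneg Metric.infDist_nonneg]
      exact h n hn x hx
    · rw [Metric.tendsto_atTop]
      intro ε hε
      obtain ⟨δ, hδ, n₀, h⟩ := h1 v ε hε
      refine ⟨n₀, fun n hn => ?_⟩
      have := h n hn v (by simpa using hδ)
      rwa [traceInterval, ← hv, uIcc_self, Metric.infDist_singleton] at this
  rcases le_or_gt α β with hαβ | hβα
  · obtain rfl := huhat_le hαβ
    have hT := fun n (hn : 1 ≤ n) => hasTracesIn_scaled hn hα hβ hαβ (hu n hn)
    refine ⟨(hasTracesIn_riemann hαβ).hasTraces, fun n hn => (hT n hn).hasTraces, fun w hw => ?_⟩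
    have key : ∀ n : ℕ, 1 ≤ n → ∀ v x, v = 0 ∨ (0 < v ∧ 0 < x) ∨ (v < 0 ∧ x < 0) →
        Metric.infDist (w n x) (traceInterval (riemann α β) v) ≤ 1 / n := fun n hn v x hvx =>
      infDist_traceInterval_riemann_le hFnn hα hβ hαβ hn (hT n hn) hvx (hw n hn x)
    have hlarge : ∀ ε > 0, ∃ n₀ : ℕ, ∀ n ≥ n₀, 1 ≤ n ∧ 1 / (n : ℝ) < ε := by
      intro ε hε
      obtain ⟨n₀, hn₀⟩ := exists_nat_gt (1 / ε)
      refine ⟨n₀, fun n hn => ?_⟩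
      have h1 : 1 / ε < n := hn₀.trans_le (by exact_mod_cast hn)
      have h2 : (0 : ℝ) < n := (one_div_pos.2 hε).trans h1
      refine ⟨by exact_mod_cast h2, ?_⟩
      rw [div_lt_iff₀ hε] at h1
      rw [div_lt_iff₀ h2]
      linarith
    refine ⟨fun v ε hε => ?_, fun v _ ε hε => ?_⟩
    · obtain ⟨n₀, hn₀⟩ := hlarge ε hε
      rcases eq_or_ne v 0 with hv | hv
      · exact ⟨1, one_pos, n₀, fun n hn x _ =>
          (key n (hn₀ n hn).1 v x (Or.inl hv)).trans_lt (hn₀ n hn).2⟩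
      · refine ⟨|v|, abs_pos.2 hv, n₀, fun n hn x hx =>
          (key n (hn₀ n hn).1 v x (Or.inr ?_)).trans_lt (hn₀ n hn).2⟩
        rcases hv.lt_or_gt with h | h
        · rw [abs_of_neg h] at hx
          exact Or.inr ⟨h, by linarith [(abs_lt.1 hx).2]⟩
        · rw [abs_of_pos h] at hx
          exact Or.inl ⟨h, by linarith [(abs_lt.1 hx).1]⟩
    · obtain ⟨n₀, hn₀⟩ := hlarge ε hε
      refine ⟨1, one_pos, n₀, fun n hn x _ =>
        (key n (hn₀ n hn).1 x x ?_).trans_lt (hn₀ n hn).2⟩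
      rcases lt_trichotomy x 0 with h | h | h
      exacts [Or.inr (Or.inr ⟨h, h⟩), Or.inl h, Or.inr (Or.inl ⟨h, h⟩)]
  · obtain ⟨U, hU, rfl⟩ := huhat_gt hβα
    have hT := fun n (hn : 1 ≤ n) => hasTracesIn_scaled_neg hn hα hβ hβα.le (hu n hn)
    have hT' : HasTracesIn (U 1) fun v => maximizers (-F) β α (-v) :=
      hasTracesIn_maximizers_neg hβα.le (hF.continuousOn.mono (Icc_subset_Icc hβ.1 hα.2)).neg
        (hU.ae_mem_maximizers_neg hK hα hβ hβα.le)
    refine ⟨hT'.hasTraces, fun n hn => (hT n hn).hasTraces, fun w hw => ?_⟩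
    have key : ∀ v, ∀ ε > 0, ∃ δ > 0, ∃ n₀ : ℕ, ∀ x, |x - v| < δ →
        (∀ n ≥ n₀, Metric.infDist (w n x) (traceInterval (U 1) v) < ε) ∧
        Metric.infDist (leftTrace (U 1) x) (traceInterval (U 1) v) < ε := by
      intro v ε hε
      obtain ⟨δ, hδ, n₀, h⟩ := exists_infDist_maximizers_scaledFlux_lt hK hFnn hβ.1 hα.2 hβα
        (hT'.subset v) hε
      refine ⟨δ, hδ, max n₀ 1, fun x hx => ⟨fun n hn => ?_, (h x hx).2 _ (hT'.left_mem x)⟩⟩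
      have hn1 : 1 ≤ n := (le_max_right _ _).trans hn
      have hn0 := (h x hx).1 n ((le_max_left _ _).trans hn) hn1
      exact infDist_lt_of_mem_traceInterval (hn0 _ ((hT n hn1).left_mem x))
        (hn0 _ ((hT n hn1).right_mem x)) (hw n hn1 x)
    refine ⟨fun v ε hε => ?_, fun v hv ε hε => ?_⟩
    · obtain ⟨δ, hδ, n₀, h⟩ := key v ε hε
      exact ⟨δ, hδ, n₀, fun n hn x hx => (h x hx).1 n hn⟩
    · -- near a continuity point `v` both `w n x` and `û(x-)` are close to `û(v)`
      replace hv := hv.resolve_left hβα.not_ge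
      obtain ⟨δ, hδ, n₀, h⟩ := key v (ε / 2) (by linarith)
      refine ⟨δ, hδ, n₀, fun n hn x hx => ?_⟩
      obtain ⟨h1, h2⟩ := h x hx
      have h3 := h1 n hn
      rw [traceInterval, ← hv, uIcc_self, Metric.infDist_singleton] at h2 h3
      have h4 : leftTrace (U 1) x ∈ traceInterval (U 1) x := left_mem_uIcc
      calc Metric.infDist (w n x) (traceInterval (U 1) x) ≤ dist (w n x) (leftTrace (U 1) x) :=
            Metric.infDist_le_dist_of_mem h4
        _ ≤ dist (w n x) (leftTrace (U 1) v) + dist (leftTrace (U 1) x) (leftTrace (U 1) v) :=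
            dist_triangle_right _ _ _
        _ < ε := by linarith
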